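/- Let $l\ge 0$ and $n,m\ge 2$ be integers, and put $N=(1,\dots,1,n,m)$ with $l$ ones, so that $|N|=l+n+m$. For $u,v\in\mathbb C^k$ write $u\bullet v=\sum_j u_jv_j$ and $|u|=\sqrt{u\bullet\bar u}$. Points of $\mathbb C^{|N|+2}=\mathbb C^l\times\mathbb C^{n+1}\times\mathbb C^{m+1}$ are written $Z=(x,z,w)$ and $\Theta=(\xi,\zeta,\eta)$. Let $\mathbb B_N$ be the open Euclidean unit ball of $\mathbb C^{|N|+2}$, let $$\mathbb H_N=\{(x,z,w)\in\mathbb C^l\times(\mathbb C^{n+1}\setminus\{0\})\times(\mathbb C^{m+1}\setminus\{0\}) : z\bullet z=w\bullet w=0\},\qquad \mathbb M_N=\mathbb H_N\cap\mathbb B_N,$$ and let $dV$ be the canonical volume measure of the complex manifold $\mathbb H_N$, i.e. the $2|N|$-dimensional volume induced from the Euclidean space $\mathbb C^{|N|+2}$. **Theorem 7.1.** Let $\lambda>0$ and let $\alpha_1,\alpha_2,\alpha_3,\alpha_4$ be real numbers with $0\le\alpha_3,\alpha_4<2$, $0\le\alpha_1+\alpha_3<2n$ and $0\le\alpha_2+\alpha_4<2m$.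 Then there is a finite constant $C>0$, depending only on $l,n,m,\lambda,\alpha_1,\dots,\alpha_4$, such that for every $Z=(x,z,w)\in\mathbb B_N$ $$\int_{\mathbb M_N}\frac{1}{|1-\Theta\bullet\bar Z|^{|N|+1+\lambda}}\Bigl(1+\frac{|z|}{|\zeta|}\Bigr)^{\alpha_1}\Bigl(1+\frac{|w|}{|\eta|}\Bigr)^{\alpha_2}\Bigl|\frac{\zeta}{\zeta_{n+1}}\Bigr|^{\alpha_3}\Bigl|\frac{\eta}{\eta_{m+1}}\Bigr|^{\alpha_4}\,dV(\Theta)\le C\,(1-|Z|^2)^{-(\lambda+\frac{\alpha_3}{2}+\frac{\alpha_4}{2})}.$$ -/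

import Mathlib

open scoped ENNReal MeasureTheory ComplexConjugate

/-- The bilinear (not sesquilinear) product `u • v = ∑ₖ uₖ vₖ` on `ℂᵏ`. -/
noncomputable def bdot {ι : Type} [Fintype ι] (u v : EuclideanSpace ℂ ι) : ℂ :=
  ∑ k, u k * v k

/-- Coordinatewise complex conjugation on `ℂᵏ`. -/
noncomputable def vconj {ι : Type} (u : EuclideanSpace ℂ ι) : EuclideanSpace ℂ ι :=
  WithLp.toLp 2 fun k => conj (u k)

/-- The ambient space `ℂˡ × ℂⁿ⁺¹ × ℂᵐ⁺¹ = ℂ^(|N|+2)`, with its Euclidean norm, where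
`N = (1,…,1,n,m)` (`l` ones) and `|N| = l + n + m`. -/
abbrev AmbN (l n m : ℕ) : Type :=
  EuclideanSpace ℂ (Fin l ⊕ (Fin (n + 1) ⊕ Fin (m + 1)))

/-- The component in `ℂⁿ⁺¹` (`z` of `Z = (x,z,w)`, `ζ` of `Θ = (ξ,ζ,η)`). -/
noncomputable def partZ {l n m : ℕ} (Z : AmbN l n m) : EuclideanSpace ℂ (Fin (n + 1)) :=
  WithLp.toLp 2 fun j => Z (Sum.inr (Sum.inl j))

/-- The component in `ℂᵐ⁺¹` (`w` of `Z = (x,z,w)`, `η` of `Θ = (ξ,ζ,η)`). -/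
noncomputable def partW {l n m : ℕ} (Z : AmbN l n m) : EuclideanSpace ℂ (Fin (m + 1)) :=
  WithLp.toLp 2 fun k => Z (Sum.inr (Sum.inr k))

/-- The open Euclidean unit ball `𝔹_N` of `ℂ^(|N|+2)`. -/
def BallN (l n m : ℕ) : Set (AmbN l n m) := Metric.ball 0 1

/-- The complex manifold `ℍ_N`, of complex dimension `|N| = l + n + m`. -/
def HypN (l n m : ℕ) : Set (AmbN l n m) :=
  {Z | partZ Z ≠ 0 ∧ partW Z ≠ 0 ∧ bdot (partZ Z) (partZ Z) = 0 ∧ bdot (partW Z) (partW Z) = 0}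

/-- `𝕄_N = ℍ_N ∩ 𝔹_N`. -/
def ManN (l n m : ℕ) : Set (AmbN l n m) := HypN l n m ∩ BallN l n m

/-- The canonical measure `dV` on `ℍ_N`: its volume as a submanifold of real dimension `2|N|`
of Euclidean space, that is, the `2|N|`-dimensional Hausdorff measure, normalized so as to agree
with Lebesgue measure on `ℝ^(2|N|)`, restricted to `ℍ_N`. -/
noncomputable def volN (l n m : ℕ) : MeasureTheory.Measure (AmbN l n m) :=
  (μHE[2 * (l + n + m)]).restrict (HypN l n m)

/-- The kernel `K_{λ,Z}(Θ) = 1 / |1 - Θ • Z̄|^(|N|+1+λ)`. -/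
noncomputable def kernelN {l n m : ℕ} (lam : ℝ) (Z Θ : AmbN l n m) : ℝ :=
  1 / ‖1 - bdot Θ (vconj Z)‖ ^ (((l + n + m : ℕ) : ℝ) + 1 + lam)

/-!
Each block of coordinates of a point of `ℍ_N` lies on the quadric cone `v • v = 0`, where the
largest coordinate is, up to sign, a Lipschitz function of the others. So `ℍ_N` is covered by
finitely many Lipschitz graphs over coordinate subspaces `ℂ^|N|`, on which `dV` is dominated by
Lebesgue measure and the weights by products of powers of single coordinates.

The set where `|1 - Θ • Z̄|` is less than `r² / 2` lies in the ball of radius `r` around `Z`. There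
`Θ • Z̄` and `|N| - 1` coordinates of the direction of `Θ` are bi-Lipschitz coordinates on each
graph; the former ranges over a disc of radius `r² / 2` and the latter over discs of radius `O(r)`,
so the weights have integral `O(r^(2|N| + 2 - α₃ - α₄))`. Since `|1 - Θ • Z̄| ≥ (1 - |Z|²) / 2`,
summing over dyadic shells of `|1 - Θ • Z̄|` gives the bound.
-/

open MeasureTheory Metric
open scoped NNReal

/-! ### Hausdorff measures, product integrals and power singularities -/

section Hausdorff

variable {X E : Type*} [EMetricSpace X] [MeasurableSpace X] [BorelSpace X]

theorem euclideanHausdorffMeasure_le_mul_image {Y : Type*} [EMetricSpace Y] [MeasurableSpace Y]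
    [BorelSpace Y] (d : ℕ) {K : ℝ≥0} {S A : Set X} {p : X → Y}
    (hp : AntilipschitzWith K (S.domRestrict p)) (hA : A ⊆ S) :
    (μHE[d] : Measure X) A ≤ (K : ℝ≥0∞) ^ d * (μHE[d] : Measure Y) (p '' A) := by
  have h := hp.le_hausdorffMeasure_image d.cast_nonneg (Subtype.val ⁻¹' A)
  rw [← isometry_subtype_coe.hausdorffMeasure_image (Or.inl d.cast_nonneg), Set.domRestrict_eq,
    Set.image_comp, Subtype.image_preimage_coe, Set.inter_eq_right.mpr hA,
    ENNReal.rpow_natCast] at h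
  simp only [Measure.euclideanHausdorffMeasure_def, Measure.smul_apply, ENNReal.smul_def,
    smul_eq_mul]
  rw [mul_left_comm]
  gcongr

variable [NormedAddCommGroup E] [NormedSpace ℝ E] [FiniteDimensional ℝ E] [MeasurableSpace E]
  [BorelSpace E] (μ : Measure E) [μ.IsAddHaarMeasure]

theorem map_restrict_euclideanHausdorffMeasure_le {K : ℝ≥0} {S : Set X} {p : X → E}
    (hp : Measurable p) (hK : AntilipschitzWith K (S.domRestrict p)) :
    ((μHE[Module.finrank ℝ E] : Measure X).restrict S).map p
      ≤ (K ^ Module.finrank ℝ E *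
          Measure.addHaarScalarFactor (μHE[Module.finrank ℝ E] : Measure E) μ) • μ := by
  refine Measure.le_iff.mpr fun B hB => ?_
  rw [Measure.map_apply hp hB, Measure.restrict_apply (hp hB)]
  calc (μHE[Module.finrank ℝ E] : Measure X) (p ⁻¹' B ∩ S)
      ≤ (K : ℝ≥0∞) ^ Module.finrank ℝ E *
          (μHE[Module.finrank ℝ E] : Measure E) (p '' (p ⁻¹' B ∩ S)) :=
        euclideanHausdorffMeasure_le_mul_image _ hK Set.inter_subset_right
    _ ≤ (K : ℝ≥0∞) ^ Module.finrank ℝ E * (μHE[Module.finrank ℝ E] : Measure E) B := by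
        gcongr
        exact Set.image_subset_iff.mpr Set.inter_subset_left
    _ = _ := by
        conv_lhs => rw [Measure.isAddLeftInvariant_eq_smul (μHE[Module.finrank ℝ E]) μ]
        simp only [Measure.smul_apply, ENNReal.smul_def, smul_eq_mul, ENNReal.coe_mul,
          ENNReal.coe_pow, mul_assoc]

theorem exists_setLIntegral_euclideanHausdorffMeasure_le (K : ℝ≥0) :
    ∃ C : ℝ≥0, ∀ (S : Set X) (p : X → E) (f : X → ℝ≥0∞) (g : E → ℝ≥0∞),
      Measurable p → Measurable g → AntilipschitzWith K (S.domRestrict p) →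
      (∀ x ∈ S, f x ≤ g (p x)) →
      ∫⁻ x in S, f x ∂μHE[Module.finrank ℝ E] ≤ C * ∫⁻ y, g y ∂μ := by
  refine ⟨K ^ Module.finrank ℝ E *
    Measure.addHaarScalarFactor (μHE[Module.finrank ℝ E] : Measure E) μ,
    fun S p f g hp hg hK hfg => ?_⟩
  calc ∫⁻ x in S, f x ∂μHE[Module.finrank ℝ E]
      ≤ ∫⁻ x in S, g (p x) ∂μHE[Module.finrank ℝ E] := setLIntegral_mono (hg.comp hp) hfg
    _ = ∫⁻ y, g y ∂((μHE[Module.finrank ℝ E] : Measure X).restrict S).map p :=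
        (lintegral_map hg hp).symm
    _ ≤ _ := lintegral_mono' (map_restrict_euclideanHausdorffMeasure_le μ hp hK) le_rfl
    _ = _ := lintegral_smul_measure _ _

end Hausdorff

theorem lintegral_prod_apply_eq_prod_lintegral {ι E : Type*} [Fintype ι] [MeasurableSpace E]
    (μ : ι → Measure E) [∀ i, SigmaFinite (μ i)] {f : ι → E → ℝ≥0∞}
    (hf : ∀ i, Measurable (f i)) :
    ∫⁻ y, ∏ i, f i (y i) ∂Measure.pi μ = ∏ i, ∫⁻ x, f i x ∂μ i := by
  classical
  have hmeas (s : Finset ι) : Measurable fun y : ι → E => ∏ i ∈ s, f i (y i) :=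
    Finset.measurable_prod _ fun i _ => (hf i).comp (measurable_pi_apply i)
  suffices key : ∀ s : Finset ι, ∀ x : ι → E,
      (∫⋯∫⁻_s, (fun y => ∏ i ∈ s, f i (y i)) ∂μ) x = ∏ i ∈ s, ∫⁻ a, f i a ∂μ i by
    rcases isEmpty_or_nonempty (ι → E) with h | ⟨⟨x₀⟩⟩
    · obtain ⟨i, hi⟩ := isEmpty_pi.mp h
      rw [lintegral_of_isEmpty, eq_comm]
      exact Finset.prod_eq_zero (Finset.mem_univ i) (lintegral_of_isEmpty _ _)
    · rw [lintegral_eq_lmarginal_univ x₀, key]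
  intro s
  induction s using Finset.induction_on with
  | empty => simp
  | insert i s hi ih =>
    intro x
    have hfactor (y : ι → E) : ∫⁻ a, ∏ j ∈ insert i s, f j (Function.update y i a j) ∂μ i
        = (∫⁻ a, f i a ∂μ i) * ∏ j ∈ s, f j (y j) := by
      rw [← lintegral_mul_const _ (hf i)]
      refine lintegral_congr fun a => ?_
      rw [Finset.prod_insert hi, Function.update_self]
      congr 1
      exact Finset.prod_congr rfl fun j hj => by
        rw [Function.update_of_ne (ne_of_mem_of_not_mem hj hi)]
    rw [lmarginal_insert' _ (hmeas _) hi, Finset.prod_insert hi, ← ih x]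
    simp only [hfactor]
    exact lintegral_const_mul _ ((hmeas s).comp measurable_updateFinset)

theorem lintegral_prod_apply_le {ι E : Type*} [Fintype ι] [MeasurableSpace E] (μ : Measure E)
    [SigmaFinite μ] {f : ι → E → ℝ≥0∞} (hf : ∀ i, Measurable (f i)) {c : ι → ℝ≥0} {e : ι → ℝ}
    {r : ℝ} (hr : 0 < r) (hbound : ∀ i, ∫⁻ x, f i x ∂μ ≤ c i * ENNReal.ofReal (r ^ e i)) :
    ∫⁻ y, ∏ i, f i (y i) ∂Measure.pi (fun _ => μ)
      ≤ (∏ i, c i : ℝ≥0) * ENNReal.ofReal (r ^ ∑ i, e i) := by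
  rw [lintegral_prod_apply_eq_prod_lintegral _ hf, Real.rpow_sum_of_pos hr,
    ENNReal.ofReal_prod_of_nonneg fun i _ => Real.rpow_nonneg hr.le _, ENNReal.ofNNReal_finsetProd,
    ← Finset.prod_mul_distrib]
  exact Finset.prod_le_prod' fun i _ => hbound i

section PowerSingularity

variable {E : Type*} [NormedAddCommGroup E] [NormedSpace ℝ E] [FiniteDimensional ℝ E]
  [MeasurableSpace E] [BorelSpace E] (μ : Measure E) [μ.IsAddHaarMeasure] {γ : ℝ}

theorem lintegral_closedBall_enorm_inv_rpow_lt_top (hγ : 0 ≤ γ) (h : γ < Module.finrank ℝ E) :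
    ∫⁻ y in closedBall (0 : E) 1, (‖y‖ₑ⁻¹) ^ γ ∂μ < ∞ := by
  have hdim : 0 < Module.finrank ℝ E := by exact_mod_cast hγ.trans_lt h
  have : Nontrivial E := Module.finrank_pos_iff.mp hdim
  have hradial : IntegrableOn (fun s : ℝ => s ^ (Module.finrank ℝ E - 1) • s ^ (-γ))
      (Set.Ioo 0 2) := by
    have hrpow : IntegrableOn (fun s : ℝ => s ^ ((Module.finrank ℝ E : ℝ) - 1 - γ))
        (Set.Ioo 0 2) :=
      (intervalIntegral.integrableOn_Ioo_rpow_iff two_pos).mpr (by linarith)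
    refine hrpow.congr_fun (fun s hs => ?_) measurableSet_Ioo
    rw [smul_eq_mul, ← Real.rpow_natCast, ← Real.rpow_add hs.1, Nat.cast_pred hdim, sub_eq_add_neg]
  have hint : IntegrableOn (fun y : E => ‖y‖ ^ (-γ)) (ball 0 2) μ :=
    (integrableOn_fun_norm_addHaar μ).mpr hradial
  calc ∫⁻ y in closedBall (0 : E) 1, (‖y‖ₑ⁻¹) ^ γ ∂μ
      ≤ ∫⁻ y in ball (0 : E) 2, (‖y‖ₑ⁻¹) ^ γ ∂μ :=
        lintegral_mono_set (closedBall_subset_ball one_lt_two)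
    _ = ∫⁻ y in ball (0 : E) 2, ‖‖y‖ ^ (-γ)‖ₑ ∂μ := by
        refine lintegral_congr_ae (ae_restrict_of_ae ?_)
        filter_upwards [compl_mem_ae_iff.mpr (measure_singleton (0 : E))] with y hy
        have hy : 0 < ‖y‖ := norm_pos_iff.mpr hy
        rw [← ofReal_norm, ← ENNReal.ofReal_inv_of_pos hy,
          ENNReal.ofReal_rpow_of_pos (inv_pos.mpr hy), Real.inv_rpow hy.le, Real.rpow_neg hy.le,
          Real.enorm_of_nonneg (by positivity)]
    _ < ∞ := hint.hasFiniteIntegral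

theorem lintegral_closedBall_zero_enorm_inv_rpow (hγ : 0 ≤ γ) {ρ : ℝ} (hρ : 0 < ρ) :
    ∫⁻ y in closedBall (0 : E) ρ, (‖y‖ₑ⁻¹) ^ γ ∂μ
      = ENNReal.ofReal (ρ ^ (Module.finrank ℝ E - γ))
        * ∫⁻ y in closedBall (0 : E) 1, (‖y‖ₑ⁻¹) ^ γ ∂μ := by
  have hμ : μ = ENNReal.ofReal (ρ ^ Module.finrank ℝ E) • μ.map (ρ • ·) := by
    rw [Measure.map_addHaar_smul μ hρ.ne', abs_of_pos (by positivity), smul_smul,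
      ← ENNReal.ofReal_mul (by positivity), mul_inv_cancel₀ (by positivity), ENNReal.ofReal_one,
      one_smul]
  have hpreimage : (ρ • · : E → E) ⁻¹' closedBall 0 ρ = closedBall 0 1 := by
    rw [Set.preimage_smul₀ hρ.ne', smul_closedBall' (inv_ne_zero hρ.ne')]
    simp [abs_of_pos hρ, hρ.ne']
  have hscale (y : E) : (‖ρ • y‖ₑ⁻¹) ^ γ = ENNReal.ofReal (ρ⁻¹ ^ γ) * (‖y‖ₑ⁻¹) ^ γ := by
    rw [enorm_smul, Real.enorm_of_nonneg hρ.le, ENNReal.mul_inv (by simp [hρ]) (by simp),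
      ENNReal.mul_rpow_of_nonneg _ _ hγ, ← ENNReal.ofReal_inv_of_pos hρ,
      ENNReal.ofReal_rpow_of_pos (inv_pos.mpr hρ)]
  conv_lhs => rw [hμ]
  rw [setLIntegral_smul_measure, setLIntegral_map isClosed_closedBall.measurableSet (by fun_prop)
    (by fun_prop), hpreimage]
  simp only [hscale]
  rw [lintegral_const_mul _ (by fun_prop), smul_eq_mul, ← mul_assoc,
    ← ENNReal.ofReal_mul (by positivity), Real.inv_rpow hρ.le, Real.rpow_sub hρ,
    Real.rpow_natCast, div_eq_mul_inv]

theorem setLIntegral_sdiff_closedBall_enorm_inv_rpow_le (hγ : 0 ≤ γ) (a : E) {ρ : ℝ}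
    (hρ : 0 < ρ) :
    ∫⁻ y in closedBall a ρ \ closedBall 0 ρ, (‖y‖ₑ⁻¹) ^ γ ∂μ
      ≤ ENNReal.ofReal (ρ ^ (Module.finrank ℝ E - γ)) * μ (closedBall 0 1) := by
  calc ∫⁻ y in closedBall a ρ \ closedBall 0 ρ, (‖y‖ₑ⁻¹) ^ γ ∂μ
      ≤ ∫⁻ _ in closedBall a ρ \ closedBall 0 ρ, ENNReal.ofReal (ρ⁻¹ ^ γ) ∂μ := by
        refine setLIntegral_mono measurable_const fun y hy => ?_
        have hy : ρ ≤ ‖y‖ := le_of_lt (by simpa using hy.2)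
        rw [← ENNReal.ofReal_rpow_of_pos (inv_pos.mpr hρ), ENNReal.ofReal_inv_of_pos hρ,
          ← ofReal_norm]
        gcongr
    _ ≤ ENNReal.ofReal (ρ⁻¹ ^ γ) * μ (closedBall a ρ) := by
        rw [setLIntegral_const]
        gcongr
        exact Set.sdiff_subset
    _ = _ := by
        rw [Measure.addHaar_closedBall' μ a hρ.le, ← mul_assoc,
          ← ENNReal.ofReal_mul (by positivity), Real.inv_rpow hρ.le, Real.rpow_sub hρ,
          Real.rpow_natCast, inv_mul_eq_div]

theorem exists_lintegral_closedBall_enorm_inv_rpow_le (hγ : 0 ≤ γ)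
    (h : γ < Module.finrank ℝ E) :
    ∃ C : ℝ≥0, ∀ (a : E) (ρ : ℝ), 0 < ρ →
      ∫⁻ y in closedBall a ρ, (‖y‖ₑ⁻¹) ^ γ ∂μ
        ≤ C * ENNReal.ofReal (ρ ^ (Module.finrank ℝ E - γ)) := by
  lift ∫⁻ y in closedBall (0 : E) 1, (‖y‖ₑ⁻¹) ^ γ ∂μ to ℝ≥0
    using (lintegral_closedBall_enorm_inv_rpow_lt_top μ hγ h).ne with C₁ hC₁
  lift μ (closedBall (0 : E) 1) to ℝ≥0
    using (isCompact_closedBall (0 : E) 1).measure_lt_top.ne with C₂ hC₂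
  refine ⟨C₁ + C₂, fun a ρ hρ => ?_⟩
  calc ∫⁻ y in closedBall a ρ, (‖y‖ₑ⁻¹) ^ γ ∂μ
      ≤ (∫⁻ y in closedBall a ρ \ closedBall 0 ρ, (‖y‖ₑ⁻¹) ^ γ ∂μ)
        + ∫⁻ y in closedBall (0 : E) ρ, (‖y‖ₑ⁻¹) ^ γ ∂μ :=
        (lintegral_mono_set (Set.subset_sdiff_union _ _)).trans (lintegral_union_le _ _ _)
    _ ≤ _ := add_le_add (setLIntegral_sdiff_closedBall_enorm_inv_rpow_le μ hγ a hρ)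
        (lintegral_closedBall_zero_enorm_inv_rpow μ hγ hρ).le
    _ = _ := by rw [← hC₁, ← hC₂, ENNReal.coe_add]; ring

end PowerSingularity

section Covering

variable {X : Type*} [MeasurableSpace X] {μ : Measure X}

theorem setLIntegral_le_sum_mul_of_subset_iUnion {ι : Type*} [Fintype ι] {T : Set X}
    {P : ι → Set X} (hT : T ⊆ ⋃ i, P i) {f : X → ℝ≥0∞} {b : ℝ≥0∞} {C : ι → ℝ≥0}
    (h : ∀ i, ∫⁻ x in P i, f x ∂μ ≤ C i * b) :
    ∫⁻ x in T, f x ∂μ ≤ (∑ i, C i : ℝ≥0) * b :=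
  calc ∫⁻ x in T, f x ∂μ ≤ ∫⁻ x in ⋃ i, P i, f x ∂μ := lintegral_mono_set hT
    _ ≤ ∑ i, ∫⁻ x in P i, f x ∂μ := (lintegral_iUnion_le _ _).trans_eq (tsum_fintype _)
    _ ≤ ∑ i, C i * b := Finset.sum_le_sum fun i _ => h i
    _ = _ := by rw [← Finset.sum_mul, ENNReal.ofNNReal_finsetSum]

theorem setLIntegral_rpow_neg_mul_le_of_sublevel {T : Set X} {F : X → ℝ} {w : X → ℝ≥0∞}
    (hw : Measurable w) {e p τ : ℝ} {C : ℝ≥0} (hp : 0 ≤ p) (hep : e < p) (hτ : 0 < τ)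
    (hF : ∀ x ∈ T, τ ≤ F x)
    (hC : ∀ t, 0 < t → ∫⁻ x in {x ∈ T | F x < t}, w x ∂μ ≤ C * ENNReal.ofReal (t ^ e)) :
    ∫⁻ x in T, ENNReal.ofReal (F x ^ (-p)) * w x ∂μ
      ≤ C * ENNReal.ofReal (2 ^ e * (1 - 2 ^ (e - p))⁻¹ * τ ^ (e - p)) := by
  set shell : ℕ → Set X := fun k => {x ∈ T | 2 ^ k * τ ≤ F x ∧ F x < 2 ^ (k + 1) * τ}
  have hcover : T ⊆ ⋃ k, shell k := fun x hx => by
    obtain ⟨k, hk, hk'⟩ := exists_nat_pow_near ((one_le_div hτ).mpr (hF x hx)) one_lt_two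
    exact Set.mem_iUnion.mpr ⟨k, hx, (le_div_iff₀ hτ).mp hk, (div_lt_iff₀ hτ).mp hk'⟩
  have hq : (2 : ℝ) ^ (e - p) < 1 := Real.rpow_lt_one_of_one_lt_of_neg one_lt_two (by linarith)
  have hshell (k : ℕ) : ∫⁻ x in shell k, ENNReal.ofReal (F x ^ (-p)) * w x ∂μ
      ≤ C * ENNReal.ofReal (2 ^ e * τ ^ (e - p)) * ENNReal.ofReal (2 ^ (e - p)) ^ k := by
    have hk : 0 < 2 ^ k * τ := by positivity
    calc ∫⁻ x in shell k, ENNReal.ofReal (F x ^ (-p)) * w x ∂μ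
        ≤ ∫⁻ x in shell k, ENNReal.ofReal ((2 ^ k * τ) ^ (-p)) * w x ∂μ := by
          refine setLIntegral_mono (by fun_prop) fun x hx => ?_
          exact mul_le_mul' (ENNReal.ofReal_le_ofReal
            (Real.rpow_le_rpow_of_nonpos hk hx.2.1 (neg_nonpos.mpr hp))) le_rfl
      _ ≤ ENNReal.ofReal ((2 ^ k * τ) ^ (-p)) *
            (C * ENNReal.ofReal ((2 ^ (k + 1) * τ) ^ e)) := by
          rw [lintegral_const_mul _ hw]
          gcongr
          refine (lintegral_mono_set ?_).trans (hC _ (by positivity))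
          exact fun x hx => ⟨hx.1, hx.2.2⟩
      _ = _ := by
          rw [mul_left_comm, mul_assoc, ← ENNReal.ofReal_mul (by positivity),
            ← ENNReal.ofReal_pow (by positivity), ← ENNReal.ofReal_mul (by positivity)]
          congr 2
          rw [Real.rpow_neg hk.le, pow_succ', mul_assoc, Real.mul_rpow two_pos.le hk.le,
            mul_left_comm, ← div_eq_inv_mul, ← Real.rpow_sub hk,
            Real.mul_rpow (by positivity) hτ.le, ← Real.rpow_natCast, ← Real.rpow_natCast,
            ← Real.rpow_mul two_pos.le, ← Real.rpow_mul two_pos.le, mul_comm (k : ℝ)]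
          ring
  calc ∫⁻ x in T, ENNReal.ofReal (F x ^ (-p)) * w x ∂μ
      ≤ ∑' k, ∫⁻ x in shell k, ENNReal.ofReal (F x ^ (-p)) * w x ∂μ :=
        (lintegral_mono_set hcover).trans (lintegral_iUnion_le _ _)
    _ ≤ ∑' k, C * ENNReal.ofReal (2 ^ e * τ ^ (e - p)) * ENNReal.ofReal (2 ^ (e - p)) ^ k :=
        ENNReal.tsum_le_tsum hshell
    _ = _ := by
        rw [ENNReal.tsum_mul_left, ENNReal.tsum_geometric, ← ENNReal.ofReal_one,
          ← ENNReal.ofReal_sub _ (by positivity), ← ENNReal.ofReal_inv_of_pos (by linarith),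
          mul_assoc, ← ENNReal.ofReal_mul (by positivity)]
        congr 2
        ring

end Covering

/-! ### Singular weights -/

section SingularWeight

variable {E : Type*} [NormedAddCommGroup E] {δ κ r : ℝ}

/-- The model singularity `|y|^{-κ} max(1, r/|y|)^δ`: of order `κ` at scale `r` and beyond, and of
order `δ + κ` at the origin. It takes the value `∞` at `y = 0` unless `δ = κ = 0` or `r ≤ 0`. -/
noncomputable def singularWeight (δ κ r : ℝ) (y : E) : ℝ≥0∞ :=
  max 1 (ENNReal.ofReal r / ‖y‖ₑ) ^ δ * (‖y‖ₑ⁻¹) ^ κ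

theorem measurable_singularWeight [MeasurableSpace E] [OpensMeasurableSpace E] (δ κ r : ℝ) :
    Measurable (singularWeight δ κ r : E → ℝ≥0∞) := by
  unfold singularWeight; fun_prop

theorem singularWeight_zero_zero (r : ℝ) (y : E) : singularWeight 0 0 r y = 1 := by
  simp [singularWeight]

theorem singularWeight_of_norm_eq_one {y : E} (hy : ‖y‖ = 1) (hr : r ≤ 1) :
    singularWeight δ κ r y = 1 := by
  simp [singularWeight, ← ofReal_norm, hy, hr]

theorem singularWeight_le_of_mul_norm_le {F : Type*} [NormedAddCommGroup F] (hδ : 0 ≤ δ)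
    (hκ : 0 ≤ κ) {c : ℝ} (hc : 0 < c) (hc1 : c ≤ 1) {y : E} {v : F} (h : c * ‖v‖ ≤ ‖y‖) :
    singularWeight δ κ r y ≤ ENNReal.ofReal (c⁻¹ ^ (δ + κ)) * singularWeight δ κ r v := by
  have hinv : ‖y‖ₑ⁻¹ ≤ ENNReal.ofReal c⁻¹ * ‖v‖ₑ⁻¹ := by
    rw [ENNReal.ofReal_inv_of_pos hc, ← ENNReal.mul_inv (by simp [hc]) (by simp),
      ENNReal.inv_le_inv, ← ofReal_norm, ← ofReal_norm, ← ENNReal.ofReal_mul hc.le]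
    exact ENNReal.ofReal_le_ofReal h
  have hone : 1 ≤ ENNReal.ofReal c⁻¹ := by
    rw [← ENNReal.ofReal_one]
    exact ENNReal.ofReal_le_ofReal ((one_le_inv₀ hc).mpr hc1)
  have hmax : max 1 (ENNReal.ofReal r / ‖y‖ₑ)
      ≤ ENNReal.ofReal c⁻¹ * max 1 (ENNReal.ofReal r / ‖v‖ₑ) := by
    refine max_le (hone.trans (le_mul_of_one_le_right zero_le (le_max_left _ _))) ?_
    calc ENNReal.ofReal r / ‖y‖ₑ ≤ ENNReal.ofReal r * (ENNReal.ofReal c⁻¹ * ‖v‖ₑ⁻¹) := by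
          rw [div_eq_mul_inv]; gcongr
      _ = ENNReal.ofReal c⁻¹ * (ENNReal.ofReal r / ‖v‖ₑ) := by rw [div_eq_mul_inv]; ring
      _ ≤ _ := by gcongr; exact le_max_right _ _
  calc singularWeight δ κ r y
      ≤ (ENNReal.ofReal c⁻¹ * max 1 (ENNReal.ofReal r / ‖v‖ₑ)) ^ δ
          * (ENNReal.ofReal c⁻¹ * ‖v‖ₑ⁻¹) ^ κ := by unfold singularWeight; gcongr
    _ = _ := by
        have hci : 0 < c⁻¹ := inv_pos.mpr hc
        rw [ENNReal.mul_rpow_of_nonneg _ _ hδ, ENNReal.mul_rpow_of_nonneg _ _ hκ,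
          Real.rpow_add hci, ENNReal.ofReal_mul (by positivity),
          ENNReal.ofReal_rpow_of_pos hci, ENNReal.ofReal_rpow_of_pos hci, singularWeight]
        ring

theorem singularWeight_le_add (hδ : 0 ≤ δ) (hκ : 0 ≤ κ) (hr : 0 < r) (y : E) :
    singularWeight δ κ r y
      ≤ (‖y‖ₑ⁻¹) ^ κ + ENNReal.ofReal (r ^ δ) * (‖y‖ₑ⁻¹) ^ (δ + κ) := by
  have hmax (x : ℝ≥0∞) : max 1 x ^ δ ≤ 1 + x ^ δ := by
    rcases le_total x 1 with hx | hx
    · simp [max_eq_left hx]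
    · simp [max_eq_right hx]
  calc singularWeight δ κ r y
      ≤ (1 + (ENNReal.ofReal r / ‖y‖ₑ) ^ δ) * (‖y‖ₑ⁻¹) ^ κ := mul_le_mul' (hmax _) le_rfl
    _ = _ := by
        rw [div_eq_mul_inv, ENNReal.mul_rpow_of_nonneg _ _ hδ, ENNReal.ofReal_rpow_of_pos hr,
          ENNReal.rpow_add_of_nonneg _ _ hδ hκ]
        ring

theorem exists_setLIntegral_singularWeight_le [NormedSpace ℝ E] [FiniteDimensional ℝ E]
    [MeasurableSpace E] [BorelSpace E] (μ : Measure E) [μ.IsAddHaarMeasure]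
    (hδ : 0 ≤ δ) (hκ : 0 ≤ κ) (h : δ + κ < Module.finrank ℝ E) {A : ℝ} (hA : 0 < A) :
    ∃ C : ℝ≥0, ∀ (a : E) (r : ℝ), 0 < r →
      ∫⁻ y in closedBall a (A * r), singularWeight δ κ r y ∂μ
        ≤ C * ENNReal.ofReal (r ^ (Module.finrank ℝ E - κ)) := by
  obtain ⟨C₁, h₁⟩ :=
    exists_lintegral_closedBall_enorm_inv_rpow_le μ hκ (by linarith)
  obtain ⟨C₂, h₂⟩ :=
    exists_lintegral_closedBall_enorm_inv_rpow_le μ (add_nonneg hδ hκ) h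
  set d := (Module.finrank ℝ E : ℝ)
  refine ⟨C₁ * (A ^ (d - κ)).toNNReal + C₂ * (A ^ (d - (δ + κ))).toNNReal, fun a r hr => ?_⟩
  have hscale (e : ℝ) : ENNReal.ofReal ((A * r) ^ e)
      = ENNReal.ofReal (A ^ e) * ENNReal.ofReal (r ^ e) := by
    rw [Real.mul_rpow hA.le hr.le, ENNReal.ofReal_mul (by positivity)]
  calc ∫⁻ y in closedBall a (A * r), singularWeight δ κ r y ∂μ
      ≤ ∫⁻ y in closedBall a (A * r),
          (‖y‖ₑ⁻¹) ^ κ + ENNReal.ofReal (r ^ δ) * (‖y‖ₑ⁻¹) ^ (δ + κ) ∂μ :=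
        lintegral_mono (singularWeight_le_add hδ hκ hr)
    _ = (∫⁻ y in closedBall a (A * r), (‖y‖ₑ⁻¹) ^ κ ∂μ)
          + ENNReal.ofReal (r ^ δ) * ∫⁻ y in closedBall a (A * r), (‖y‖ₑ⁻¹) ^ (δ + κ) ∂μ := by
        rw [lintegral_add_left (by fun_prop), lintegral_const_mul _ (by fun_prop)]
    _ ≤ C₁ * ENNReal.ofReal ((A * r) ^ (d - κ))
          + ENNReal.ofReal (r ^ δ) * (C₂ * ENNReal.ofReal ((A * r) ^ (d - (δ + κ)))) := by
        gcongr
        · exact h₁ a _ (mul_pos hA hr)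
        · exact h₂ a _ (mul_pos hA hr)
    _ = _ := by
        rw [hscale, hscale, show d - κ = δ + (d - (δ + κ)) by ring, Real.rpow_add hr,
          ENNReal.ofReal_mul (by positivity)]
        simp only [ENNReal.coe_add, ENNReal.coe_mul, ← ENNReal.ofReal.eq_1]
        ring

end SingularWeight

/-- Exponents for which the product over `i ∈ J` of `singularWeight (δ i) (κ i) r (y i)` is locally
integrable on `ℂ^J`. The exponents vanish off `J`, so that the product may also be taken over all
indices. -/
structure AdmissibleExponents {ι : Type*} (J : Finset ι) (δ κ : ι → ℝ) : Prop where
  left_nonneg : ∀ i, 0 ≤ δ i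
  right_nonneg : ∀ i, 0 ≤ κ i
  add_lt_two : ∀ i, δ i + κ i < 2
  left_eq_zero : ∀ i ∉ J, δ i = 0
  right_eq_zero : ∀ i ∉ J, κ i = 0

section Exponents

variable {ι : Type*}

theorem exists_sum_eq_of_lt_sum {J : Finset ι} {c : ι → ℝ} {β : ℝ} (hc : ∀ i ∈ J, 0 < c i)
    (hβ : 0 ≤ β) (h : β < ∑ i ∈ J, c i) :
    ∃ δ : ι → ℝ, (∀ i, 0 ≤ δ i) ∧ (∀ i ∈ J, δ i < c i) ∧ (∀ i ∉ J, δ i = 0) ∧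
      ∑ i ∈ J, δ i = β := by
  classical
  have hsum : 0 < ∑ i ∈ J, c i := hβ.trans_lt h
  refine ⟨fun i => if i ∈ J then β / (∑ i ∈ J, c i) * c i else 0, fun i => ?_, fun i hi => ?_,
    fun i hi => if_neg hi, ?_⟩
  · dsimp only
    split_ifs with hi
    · have := hc i hi
      positivity
    · rfl
  · simp only [if_pos hi]
    exact mul_lt_of_lt_one_left (hc i hi) ((div_lt_one hsum).mpr h)
  · rw [Finset.sum_congr rfl fun i hi => if_pos hi, ← Finset.mul_sum, div_mul_cancel₀ _ hsum.ne']

theorem rpow_sum_of_nonneg (s : Finset ι) (x : ℝ≥0∞) {f : ι → ℝ} (hf : ∀ i ∈ s, 0 ≤ f i) :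
    x ^ (∑ i ∈ s, f i) = ∏ i ∈ s, x ^ f i := by
  induction s using Finset.cons_induction with
  | empty => simp
  | cons i s hi ih =>
    rw [Finset.forall_mem_cons] at hf
    rw [Finset.sum_cons, Finset.prod_cons,
      ENNReal.rpow_add_of_nonneg _ _ hf.1 (Finset.sum_nonneg hf.2), ih hf.2]

theorem AdmissibleExponents.prod_singularWeight [Fintype ι] {E : Type*} [NormedAddCommGroup E]
    {J : Finset ι} {δ κ : ι → ℝ} (h : AdmissibleExponents J δ κ) (r : ℝ) (y : ι → E) :
    ∏ i, singularWeight (δ i) (κ i) r (y i) = ∏ i ∈ J, singularWeight (δ i) (κ i) r (y i) := by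
  refine (Finset.prod_subset J.subset_univ fun i _ hi => ?_).symm
  rw [h.left_eq_zero i hi, h.right_eq_zero i hi, singularWeight_zero_zero]

theorem exists_admissibleExponents_single [DecidableEq ι] {J : Finset ι} {i₁ : ι} (hi₁ : i₁ ∈ J)
    {β α : ℝ} (hβ : 0 ≤ β) (hα : 0 ≤ α) (hα2 : α < 2) (h : β + α < 2 * J.card) :
    ∃ δ : ι → ℝ, AdmissibleExponents J δ (Pi.single i₁ α) ∧ ∑ i ∈ J, δ i = β := by
  set κ : ι → ℝ := Pi.single i₁ α
  have hκ (i : ι) : 0 ≤ κ i ∧ κ i < 2 := by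
    rcases eq_or_ne i i₁ with rfl | hi <;> simp [κ, *]
  have hsum : ∑ i ∈ J, (2 - κ i) = 2 * J.card - α := by
    rw [Finset.sum_sub_distrib, Finset.sum_const, Finset.sum_pi_single', if_pos hi₁, nsmul_eq_mul,
      mul_comm]
  obtain ⟨δ, hδ, hlt, hzero, hδβ⟩ := exists_sum_eq_of_lt_sum (c := fun i => 2 - κ i)
    (fun i _ => sub_pos.mpr (hκ i).2) hβ (by linarith : β < ∑ i ∈ J, (2 - κ i))
  refine ⟨δ, ⟨hδ, fun i => (hκ i).1, fun i => ?_, hzero, fun i hi => ?_⟩, hδβ⟩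
  · by_cases hi : i ∈ J
    · linarith [hlt i hi]
    · linarith [hzero i hi, (hκ i).2]
  · exact Pi.single_eq_of_ne (ne_of_mem_of_not_mem hi₁ hi).symm _

end Exponents

section BlockWeight

variable {ι : Type*} [Fintype ι]

theorem one_add_enorm_div_le {z ζ : EuclideanSpace ℂ ι} {r : ℝ} (h : ‖ζ - z‖ ≤ r) :
    1 + ‖z‖ₑ / ‖ζ‖ₑ ≤ 3 * max 1 (ENNReal.ofReal r / ‖ζ‖ₑ) := by
  have hz : ‖z‖ₑ ≤ ‖ζ‖ₑ + ENNReal.ofReal r := by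
    rw [← ofReal_norm, ← ofReal_norm, ← ENNReal.ofReal_add (norm_nonneg _)
      ((norm_nonneg _).trans h)]
    refine ENNReal.ofReal_le_ofReal ?_
    linarith [norm_sub_norm_le z ζ, norm_sub_rev z ζ]
  calc 1 + ‖z‖ₑ / ‖ζ‖ₑ ≤ 1 + (‖ζ‖ₑ / ‖ζ‖ₑ + ENNReal.ofReal r / ‖ζ‖ₑ) := by
        rw [← ENNReal.add_div]; gcongr
    _ ≤ max 1 (ENNReal.ofReal r / ‖ζ‖ₑ)
          + (max 1 (ENNReal.ofReal r / ‖ζ‖ₑ) + max 1 (ENNReal.ofReal r / ‖ζ‖ₑ)) := by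
        gcongr
        · exact le_max_left _ _
        · exact ENNReal.div_self_le_one.trans (le_max_left _ _)
        · exact le_max_right _ _
    _ = _ := by ring

/-- The factor of the integrand carried by one of the blocks `z`, `w` of coordinates. -/
noncomputable def blockWeight (β α : ℝ) (i₀ : ι) (z ζ : EuclideanSpace ℂ ι) : ℝ≥0∞ :=
  (1 + ‖z‖ₑ / ‖ζ‖ₑ) ^ β * (‖ζ‖ₑ / ‖ζ i₀‖ₑ) ^ α

theorem measurable_blockWeight (β α : ℝ) (i₀ : ι) (z : EuclideanSpace ℂ ι) :
    Measurable (blockWeight β α i₀ z) := by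
  unfold blockWeight; fun_prop

theorem max_one_div_enorm_rpow_le_prod {J : Finset ι} {δ : ι → ℝ} (hδ : ∀ i ∈ J, 0 ≤ δ i)
    (r : ℝ) (ζ : EuclideanSpace ℂ ι) :
    max 1 (ENNReal.ofReal r / ‖ζ‖ₑ) ^ ∑ i ∈ J, δ i
      ≤ ∏ i ∈ J, max 1 (ENNReal.ofReal r / ‖ζ i‖ₑ) ^ δ i := by
  rw [rpow_sum_of_nonneg J _ hδ]
  refine Finset.prod_le_prod' fun i hi => ENNReal.rpow_le_rpow ?_ (hδ i hi)
  gcongr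
  rw [← ofReal_norm, ← ofReal_norm]
  exact ENNReal.ofReal_le_ofReal (PiLp.norm_apply_le ζ i)

theorem blockWeight_le_prod_singularWeight [DecidableEq ι] {J : Finset ι} {i₀ i₁ : ι}
    {β α r : ℝ} {δ : ι → ℝ} (hα : 0 ≤ α) (hi₁ : i₁ ∈ J)
    (hδκ : AdmissibleExponents J δ (Pi.single i₁ α)) (hδ : ∑ i ∈ J, δ i = max β 0)
    {z ζ : EuclideanSpace ℂ ι} (hi : ‖ζ i₁‖ ≤ ‖ζ i₀‖) (hζ : ‖ζ‖ ≤ 1) (hr : ‖ζ - z‖ ≤ r) :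
    blockWeight β α i₀ z ζ
      ≤ 3 ^ max β 0 * ∏ i, singularWeight (δ i) ((Pi.single i₁ α : ι → ℝ) i) r (ζ i) := by
  have hfst : (1 + ‖z‖ₑ / ‖ζ‖ₑ) ^ β
      ≤ 3 ^ max β 0 * ∏ i ∈ J, max 1 (ENNReal.ofReal r / ‖ζ i‖ₑ) ^ δ i :=
    calc (1 + ‖z‖ₑ / ‖ζ‖ₑ) ^ β ≤ (1 + ‖z‖ₑ / ‖ζ‖ₑ) ^ max β 0 :=
          ENNReal.rpow_le_rpow_of_exponent_le le_self_add (le_max_left _ _)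
      _ ≤ (3 * max 1 (ENNReal.ofReal r / ‖ζ‖ₑ)) ^ max β 0 :=
          ENNReal.rpow_le_rpow (one_add_enorm_div_le hr) (le_max_right _ _)
      _ = 3 ^ max β 0 * max 1 (ENNReal.ofReal r / ‖ζ‖ₑ) ^ ∑ i ∈ J, δ i := by
          rw [ENNReal.mul_rpow_of_nonneg _ _ (le_max_right _ _), hδ]
      _ ≤ _ := by
          gcongr
          exact max_one_div_enorm_rpow_le_prod (fun i _ => hδκ.left_nonneg i) r ζ
  have hsnd : (‖ζ‖ₑ / ‖ζ i₀‖ₑ) ^ α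
      ≤ ∏ i ∈ J, (‖ζ i‖ₑ⁻¹) ^ (Pi.single i₁ α : ι → ℝ) i := by
    rw [Finset.prod_eq_single_of_mem i₁ hi₁ fun i _ hi => by
      rw [Pi.single_eq_of_ne hi, ENNReal.rpow_zero], Pi.single_eq_same, ← one_div]
    refine ENNReal.rpow_le_rpow (ENNReal.div_le_div ?_ ?_) hα
    · simpa [← ofReal_norm] using hζ
    · simpa [← ofReal_norm] using ENNReal.ofReal_le_ofReal hi
  calc blockWeight β α i₀ z ζ ≤ _ := mul_le_mul' hfst hsnd
    _ = _ := by
        rw [hδκ.prod_singularWeight, mul_assoc, ← Finset.prod_mul_distrib]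
        rfl

/-- The coordinate `j` is the one eliminated on the quadric. When `j = i₀`, the singularity in the
direction `i₀` is transferred to another coordinate, which is smaller by dominance of `j`. -/
theorem exists_blockWeight_le_prod_singularWeight [DecidableEq ι] {β α : ℝ} (hα : 0 ≤ α)
    (hα2 : α < 2) (i₀ j : ι) (hcard : 1 < Fintype.card ι)
    (h : β + α < 2 * (Fintype.card ι - 1)) :
    ∃ (C : ℝ≥0) (δ κ : ι → ℝ), AdmissibleExponents {j}ᶜ δ κ ∧ ∑ i, κ i = α ∧
      ∀ (z ζ : EuclideanSpace ℂ ι) (r : ℝ), (∀ i, ‖ζ i‖ ≤ ‖ζ j‖) → ‖ζ‖ ≤ 1 → ‖ζ - z‖ ≤ r →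
        blockWeight β α i₀ z ζ ≤ C * ∏ i, singularWeight (δ i) (κ i) r (ζ i) := by
  have : Nontrivial ι := Fintype.one_lt_card_iff_nontrivial.mp hcard
  obtain ⟨i₁, hi₁, hdom⟩ : ∃ i₁ ≠ j, ∀ ζ : EuclideanSpace ℂ ι, (∀ i, ‖ζ i‖ ≤ ‖ζ j‖) →
      ‖ζ i₁‖ ≤ ‖ζ i₀‖ := by
    by_cases hij : i₀ = j
    · obtain ⟨i₁, hi₁⟩ := exists_ne j
      exact ⟨i₁, hi₁, fun ζ hζ => hij ▸ hζ i₁⟩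
    · exact ⟨i₀, hij, fun ζ _ => le_rfl⟩
  have hcompl : (({j}ᶜ : Finset ι).card : ℝ) = Fintype.card ι - 1 := by
    rw [Finset.card_compl, Finset.card_singleton, Nat.cast_pred (by omega)]
  have hcard' : (2 : ℝ) ≤ Fintype.card ι := by exact_mod_cast hcard
  have hmem : i₁ ∈ ({j}ᶜ : Finset ι) := by simpa using hi₁
  obtain ⟨δ, hδκ, hδ⟩ := exists_admissibleExponents_single hmem (le_max_right β 0) hα hα2 (by
    rw [hcompl, max_add, max_lt_iff]; constructor <;> linarith)
  refine ⟨3 ^ max β 0, δ, Pi.single i₁ α, hδκ, by simp, fun z ζ r hζj hζ hr => ?_⟩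
  rw [ENNReal.coe_rpow_of_nonneg _ (le_max_right _ _)]
  exact blockWeight_le_prod_singularWeight hα hmem hδκ hδ (hdom ζ hζj) hζ hr

end BlockWeight

/-! ### Lipschitz graphs over coordinate subspaces -/

section LipschitzGraph

variable {ι : Type*} {J : Finset ι}

/-- The coordinates of a vector with indices in `J`. -/
def freeCoords (J : Finset ι) (Θ : EuclideanSpace ℂ ι) : J → ℂ := fun i => Θ i

theorem measurable_freeCoords : Measurable (freeCoords J) := by
  unfold freeCoords; fun_prop

theorem finrank_pi_complex : Module.finrank ℝ (J → ℂ) = 2 * J.card := by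
  rw [Module.finrank_pi_fintype]; simp [mul_comm]

variable [Fintype ι] {S : Set (EuclideanSpace ℂ ι)} {K : ℝ≥0} {δ κ : ι → ℝ} {r : ℝ}

theorem measurable_prod_singularWeight (δ κ : ι → ℝ) (r : ℝ) :
    Measurable fun Θ : EuclideanSpace ℂ ι => ∏ i, singularWeight (δ i) (κ i) r (Θ i) :=
  Finset.measurable_fun_prod _ fun i _ =>
    (measurable_singularWeight (δ i) (κ i) r).comp (by fun_prop)

/-- `S` is the graph, over a subset of `ℂ^J`, of a Lipschitz map vanishing at the origin; the
constant `K` bounds distances in `S` by those of the coordinates in `J`. -/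
structure IsLipschitzGraphOver (J : Finset ι) (K : ℝ≥0) (S : Set (EuclideanSpace ℂ ι)) :
    Prop where
  zero_mem : 0 ∈ S
  antilipschitz : AntilipschitzWith K (S.domRestrict (freeCoords J))

namespace IsLipschitzGraphOver

theorem exists_of_norm_apply_sub_le (h0 : 0 ∈ S) (c : ℝ≥0)
    (h : ∀ Θ ∈ S, ∀ Φ ∈ S, ∀ D : ℝ, 0 ≤ D → (∀ i ∈ J, ‖Θ i - Φ i‖ ≤ D) →
      ∀ i, ‖Θ i - Φ i‖ ≤ c * D) :
    ∃ K : ℝ≥0, IsLipschitzGraphOver J K S := by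
  refine ⟨(Fintype.card ι : ℝ≥0) ^ (1 / (2 : ℝ≥0∞)).toReal * c, h0,
    AntilipschitzWith.of_le_mul_dist ?_⟩
  rintro ⟨Θ, hΘ⟩ ⟨Φ, hΦ⟩
  refine ((PiLp.antilipschitzWith_ofLp 2 fun _ : ι => ℂ).le_mul_dist Θ Φ).trans ?_
  rw [NNReal.coe_mul, mul_assoc]
  gcongr
  refine (dist_pi_le_iff (by positivity)).mpr fun i => ?_
  rw [dist_eq_norm]
  exact h Θ hΘ Φ hΦ _ dist_nonneg
    (fun i hi => (dist_eq_norm (Θ i) (Φ i)).symm.trans_le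
      (dist_le_pi_dist (freeCoords J Θ) (freeCoords J Φ) ⟨i, hi⟩)) i

theorem norm_sub_le (hS : IsLipschitzGraphOver J K S) {Θ Φ : EuclideanSpace ℂ ι} (hΘ : Θ ∈ S)
    (hΦ : Φ ∈ S) {D : ℝ} (hD : 0 ≤ D) (h : ∀ i ∈ J, ‖Θ i - Φ i‖ ≤ D) : ‖Θ - Φ‖ ≤ K * D := by
  rw [← dist_eq_norm]
  refine (hS.antilipschitz.le_mul_dist ⟨Θ, hΘ⟩ ⟨Φ, hΦ⟩).trans ?_
  gcongr
  exact (dist_pi_le_iff hD).mpr fun i => (dist_eq_norm _ _).trans_le (h i i.2)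

theorem norm_le (hS : IsLipschitzGraphOver J K S) {Θ : EuclideanSpace ℂ ι} (hΘ : Θ ∈ S) {D : ℝ}
    (hD : 0 ≤ D) (h : ∀ i ∈ J, ‖Θ i‖ ≤ D) : ‖Θ‖ ≤ K * D := by
  simpa using hS.norm_sub_le hΘ hS.zero_mem hD (by simpa using h)

theorem exists_dominant_coord (hS : IsLipschitzGraphOver J K S) {Θ : EuclideanSpace ℂ ι}
    (hΘ : Θ ∈ S) (h0 : Θ ≠ 0) : ∃ k : J, Θ k ≠ 0 ∧ ∀ i ∈ J, ‖Θ i‖ ≤ ‖Θ k‖ := by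
  obtain ⟨i, hi, hΘi⟩ : ∃ i ∈ J, Θ i ≠ 0 := by
    by_contra! h
    have := hS.norm_le hΘ le_rfl fun i hi => by simp [h i hi]
    exact h0 (norm_le_zero_iff.mp (by simpa using this))
  obtain ⟨k, hk, hmax⟩ := J.exists_max_image (fun i => ‖Θ i‖) ⟨i, hi⟩
  exact ⟨⟨k, hk⟩, norm_pos_iff.mp ((norm_pos_iff.mpr hΘi).trans_le (hmax i hi)), hmax⟩

theorem setLIntegral_prod_singularWeight_lt_top (hS : IsLipschitzGraphOver J K S)
    (h : AdmissibleExponents J δ κ) (hr : 0 < r) :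
    ∫⁻ Θ in S ∩ ball 0 1, ∏ i, singularWeight (δ i) (κ i) r (Θ i) ∂μHE[2 * J.card] < ∞ := by
  have hint (i : ι) := exists_setLIntegral_singularWeight_le (E := ℂ) volume (h.left_nonneg i)
    (h.right_nonneg i) (by simpa using h.add_lt_two i) (inv_pos.mpr hr)
  choose C hC using hint
  obtain ⟨C₀, hC₀⟩ := exists_setLIntegral_euclideanHausdorffMeasure_le
    (X := EuclideanSpace ℂ ι) (volume : Measure (J → ℂ)) K
  set f : J → ℂ → ℝ≥0∞ := fun i => (closedBall 0 (r⁻¹ * r)).indicator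
    (singularWeight (δ i) (κ i) r)
  have hf (i : J) : Measurable (f i) :=
    (measurable_singularWeight _ _ _).indicator isClosed_closedBall.measurableSet
  have hfC (i : J) : ∫⁻ y, f i y ≤ C i * ENNReal.ofReal (r ^ (2 - κ i)) := by
    rw [lintegral_indicator isClosed_closedBall.measurableSet]
    simpa using hC i 0 r hr
  have hle : ∀ Θ ∈ S ∩ ball 0 1, ∏ i, singularWeight (δ i) (κ i) r (Θ i)
      ≤ ∏ i, f i (freeCoords J Θ i) := by
    intro Θ hΘ
    rw [h.prod_singularWeight, ← Finset.prod_coe_sort]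
    refine (Finset.prod_congr rfl fun i _ => ?_).le
    have : Θ i ∈ closedBall (0 : ℂ) (r⁻¹ * r) := by
      rw [inv_mul_cancel₀ hr.ne', mem_closedBall_zero_iff]
      exact (PiLp.norm_apply_le Θ i).trans (mem_ball_zero_iff.mp hΘ.2).le
    exact (Set.indicator_of_mem this _).symm
  have hanti : AntilipschitzWith K ((S ∩ ball 0 1).domRestrict (freeCoords J)) :=
    fun Θ Φ => hS.antilipschitz ⟨Θ, Θ.2.1⟩ ⟨Φ, Φ.2.1⟩
  rw [← finrank_pi_complex]
  calc _ ≤ C₀ * ∫⁻ y : J → ℂ, ∏ i, f i (y i) :=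
        hC₀ _ _ _ (fun y => ∏ i, f i (y i)) measurable_freeCoords (by fun_prop)
          hanti hle
    _ ≤ C₀ * ((∏ i : J, C i : ℝ≥0) * ENNReal.ofReal (r ^ ∑ i : J, (2 - κ i))) := by
        gcongr
        exact lintegral_prod_apply_le volume hf hr hfC
    _ < ∞ := by finiteness

end IsLipschitzGraphOver

end LipschitzGraph

section CapMajorant

variable {ι : Type*} [DecidableEq ι] {J : Finset ι} {δ κ : ι → ℝ}

/-- A function of the cap coordinate `i` that dominates the `i`-th singular weight on a cap of
radius `r`. It restricts the coordinate `k`, that is `Θ • Z̄`, to a disc of radius `r² / 2`, and the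
other coordinates to discs of radius `A r`. -/
noncomputable def capMajorant (δ κ : ι → ℝ) (k : J) (A r : ℝ) (a : J → ℂ) (i : J) : ℂ → ℝ≥0∞ :=
  if i = k then (closedBall 1 (r ^ 2 / 2)).indicator 1
  else (closedBall (a i) (A * r)).indicator (singularWeight (δ i) (κ i) r)

theorem measurable_capMajorant (k : J) (A r : ℝ) (a : J → ℂ) (i : J) :
    Measurable (capMajorant δ κ k A r a i) := by
  unfold capMajorant
  split_ifs
  · exact measurable_one.indicator isClosed_closedBall.measurableSet
  · exact (measurable_singularWeight _ _ _).indicator isClosed_closedBall.measurableSet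

theorem exists_lintegral_capMajorant_le (h : AdmissibleExponents J δ κ) (k : J) {A : ℝ}
    (hA : 0 < A) (i : J) :
    ∃ C : ℝ≥0, ∀ (a : J → ℂ) (r : ℝ), 0 < r → r ≤ 1 →
      ∫⁻ y, capMajorant δ κ k A r a i y
        ≤ C * ENNReal.ofReal (r ^ (2 - κ i + (Pi.single k 2 : J → ℝ) i)) := by
  rcases eq_or_ne i k with rfl | hi
  · refine ⟨NNReal.pi, fun a r hr hr1 => ?_⟩
    rw [capMajorant, if_pos rfl, lintegral_indicator_one isClosed_closedBall.measurableSet,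
      Complex.volume_closedBall, mul_comm, ← ENNReal.ofReal_pow (by positivity), Pi.single_eq_same]
    gcongr
    calc (r ^ 2 / 2) ^ 2 ≤ r ^ (4 : ℝ) := by norm_cast; nlinarith [pow_pos hr 4]
      _ ≤ r ^ (2 - κ i + 2) :=
        Real.rpow_le_rpow_of_exponent_ge hr hr1 (by linarith [h.right_nonneg i])
  · obtain ⟨C, hC⟩ := exists_setLIntegral_singularWeight_le (E := ℂ) volume (h.left_nonneg i)
      (h.right_nonneg i) (by simpa using h.add_lt_two i) hA
    refine ⟨C, fun a r hr _ => ?_⟩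
    rw [capMajorant, if_neg hi, lintegral_indicator isClosed_closedBall.measurableSet]
    simpa [hi] using hC (a i) r hr

end CapMajorant

section Cap

variable {ι : Type*} [Fintype ι] {J : Finset ι} {S : Set (EuclideanSpace ℂ ι)} {K : ℝ≥0}
  {δ κ : ι → ℝ} {r : ℝ} {Z Θ Φ : EuclideanSpace ℂ ι} {k : J}

/-- The part of the unit ball where `1 - Θ • Z̄` is small: the nonisotropic ball around `Z` of
radius `r`, the size of `1 - Θ • Z̄` being comparable to the square of the radius. -/
def cap (Z : EuclideanSpace ℂ ι) (r : ℝ) : Set (EuclideanSpace ℂ ι) :=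
  {Θ | ‖Θ‖ < 1 ∧ ‖1 - inner ℂ Z Θ‖ < r ^ 2 / 2}

theorem norm_sub_le_of_mem_cap (hZ : ‖Z‖ < 1) (hr : 0 ≤ r) (h : Θ ∈ cap Z r) : ‖Θ - Z‖ ≤ r := by
  have hre : 1 - (inner ℂ Z Θ).re < r ^ 2 / 2 := by
    simpa using (Complex.re_le_norm (1 - inner ℂ Z Θ)).trans_lt h.2
  have hsq := norm_sub_sq (𝕜 := ℂ) Z Θ
  rw [norm_sub_rev] at hsq
  simp only [RCLike.re_to_complex] at hsq
  have hZsq : ‖Z‖ ^ 2 ≤ 1 := pow_le_one₀ (norm_nonneg _) hZ.le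
  have hΘsq : ‖Θ‖ ^ 2 ≤ 1 := pow_le_one₀ (norm_nonneg _) h.1.le
  exact le_of_sq_le_sq (by linarith) hr

theorem half_le_norm_inner_of_mem_cap (hr : 0 ≤ r) (hr1 : r ≤ 1) (h : Θ ∈ cap Z r) :
    1 / 2 ≤ ‖inner ℂ Z Θ‖ := by
  have htri := norm_sub_norm_le (1 : ℂ) (1 - inner ℂ Z Θ)
  rw [sub_sub_cancel, norm_one] at htri
  have hsq : r ^ 2 ≤ 1 := pow_le_one₀ hr hr1
  linarith [h.2]

/-- The vectors that have a rescaling with `k`-th coordinate `1` in `S` and whose coordinates in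
`J` are dominated by the `k`-th one. -/
def dominatedCone (S : Set (EuclideanSpace ℂ ι)) (k : J) : Set (EuclideanSpace ℂ ι) :=
  {Θ | Θ k ≠ 0 ∧ (Θ k)⁻¹ • Θ ∈ S ∧ ∀ i ∈ J, ‖Θ i‖ ≤ ‖Θ k‖}

namespace IsLipschitzGraphOver

theorem norm_direction_le (hS : IsLipschitzGraphOver J K S) (hΘ : Θ ∈ dominatedCone S k) :
    ‖(Θ k)⁻¹ • Θ‖ ≤ K := by
  simpa using hS.norm_le hΘ.2.1 zero_le_one fun i hi => by
    have := norm_pos_iff.mpr hΘ.1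
    simpa [inv_mul_le_iff₀ this] using hΘ.2.2 i hi

theorem one_le_mul_norm_coord (hS : IsLipschitzGraphOver J K S) (hZ : ‖Z‖ < 1) (hr : 0 ≤ r)
    (hr1 : r ≤ 1) (hΘ : Θ ∈ cap Z r ∩ dominatedCone S k) : 1 ≤ 2 * K * ‖Θ k‖ := by
  have h : ‖inner ℂ Z Θ‖ ≤ ‖Θ k‖ * (1 * K) := by
    conv_lhs => rw [← smul_inv_smul₀ hΘ.2.1 Θ, inner_smul_right, norm_mul]
    gcongr
    exact (norm_inner_le_norm _ _).trans (by gcongr; exact hS.norm_direction_le hΘ.2)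
  linarith [half_le_norm_inner_of_mem_cap hr hr1 hΘ.1]

theorem half_le_norm_inner_direction (hr : 0 ≤ r) (hr1 : r ≤ 1)
    (hΘ : Θ ∈ cap Z r ∩ dominatedCone S k) : 1 / 2 ≤ ‖inner ℂ Z ((Θ k)⁻¹ • Θ)‖ := by
  have h := half_le_norm_inner_of_mem_cap hr hr1 hΘ.1
  rw [← smul_inv_smul₀ hΘ.2.1 Θ, inner_smul_right, norm_mul] at h
  exact h.trans (mul_le_of_le_one_left (norm_nonneg _)
    ((PiLp.norm_apply_le Θ k).trans hΘ.1.1.le))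

theorem singularWeight_apply_le (hS : IsLipschitzGraphOver J K S) (hδκ : AdmissibleExponents J δ κ)
    (hZ : ‖Z‖ < 1) (hr : 0 ≤ r) (hr1 : r ≤ 1) (hΘ : Θ ∈ cap Z r ∩ dominatedCone S k) (i : ι) :
    singularWeight (δ i) (κ i) r (Θ i) ≤ ENNReal.ofReal ((2 * K) ^ (δ i + κ i))
      * singularWeight (δ i) (κ i) r (((Θ k)⁻¹ • Θ) i) := by
  have h1 := hS.one_le_mul_norm_coord hZ hr hr1 hΘ
  have hk : ‖Θ k‖ ≤ 1 := (PiLp.norm_apply_le Θ k).trans hΘ.1.1.le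
  have hK : 1 ≤ 2 * (K : ℝ) := h1.trans (mul_le_of_le_one_right (by positivity) hk)
  rw [← inv_inv (2 * (K : ℝ))]
  refine singularWeight_le_of_mul_norm_le (hδκ.left_nonneg i) (hδκ.right_nonneg i)
    (by positivity) (inv_le_one_of_one_le₀ hK) ?_
  have hid : ‖Θ i‖ = ‖Θ k‖ * ‖((Θ k)⁻¹ • Θ) i‖ := by
    rw [← norm_mul, ← smul_eq_mul, ← PiLp.smul_apply, smul_inv_smul₀ hΘ.2.1]
  rw [hid]
  gcongr
  rwa [inv_le_iff_one_le_mul₀ (by positivity), mul_comm]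

theorem norm_direction_sub_le_of_mem_cap (hS : IsLipschitzGraphOver J K S) (hZ : ‖Z‖ < 1)
    (hr : 0 ≤ r) (hr1 : r ≤ 1) (hΘ : Θ ∈ cap Z r ∩ dominatedCone S k)
    (hΦ : Φ ∈ cap Z r ∩ dominatedCone S k) :
    ‖(Θ k)⁻¹ • Θ - (Φ k)⁻¹ • Φ‖ ≤ 4 * K * (1 + K) * r := by
  have hdist : ‖Θ - Φ‖ ≤ r + r := by
    rw [← sub_sub_sub_cancel_right Θ Φ Z]
    exact (_root_.norm_sub_le _ _).trans (add_le_add (norm_sub_le_of_mem_cap hZ hr hΘ.1)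
      (norm_sub_le_of_mem_cap hZ hr hΦ.1))
  have hid : Θ k • ((Θ k)⁻¹ • Θ - (Φ k)⁻¹ • Φ) = (Θ - Φ) - (Θ k - Φ k) • (Φ k)⁻¹ • Φ := by
    rw [sub_smul, smul_sub, smul_inv_smul₀ hΘ.2.1 Θ, smul_inv_smul₀ hΦ.2.1 Φ]
    abel
  have hup : ‖Θ k‖ * ‖(Θ k)⁻¹ • Θ - (Φ k)⁻¹ • Φ‖ ≤ (r + r) + (r + r) * K := by
    rw [← norm_smul, hid]
    refine (_root_.norm_sub_le _ _).trans ?_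
    rw [norm_smul]
    gcongr
    · exact (PiLp.norm_apply_le (Θ - Φ) k).trans hdist
    · exact hS.norm_direction_le hΦ.2
  calc _ ≤ 2 * K * ‖Θ k‖ * ‖(Θ k)⁻¹ • Θ - (Φ k)⁻¹ • Φ‖ :=
        le_mul_of_one_le_left (norm_nonneg _) (hS.one_le_mul_norm_coord hZ hr hr1 hΘ)
    _ ≤ 2 * K * ((r + r) + (r + r) * K) := by rw [mul_assoc]; gcongr
    _ = _ := by ring

end IsLipschitzGraphOver

section CapCoord

variable [DecidableEq ι]

/-- Coordinates on a cap: the value of `Θ • Z̄` replaces the coordinate `k`, and the other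
coordinates in `J` are those of the direction `(Θ k)⁻¹ • Θ`. -/
noncomputable def capCoord (k : J) (Z Θ : EuclideanSpace ℂ ι) : J → ℂ :=
  Function.update (freeCoords J ((Θ k)⁻¹ • Θ)) k (inner ℂ Z Θ)

theorem capCoord_self : capCoord k Z Θ k = inner ℂ Z Θ := by simp [capCoord]

theorem capCoord_of_ne {i : J} (hi : i ≠ k) : capCoord k Z Θ i = ((Θ k)⁻¹ • Θ) i := by
  simp [capCoord, freeCoords, hi]

theorem measurable_capCoord (k : J) (Z : EuclideanSpace ℂ ι) : Measurable (capCoord k Z) := by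
  refine measurable_pi_iff.mpr fun i => ?_
  rcases eq_or_ne i k with rfl | hi
  · simp only [capCoord_self]
    fun_prop
  · simp only [capCoord_of_ne hi, PiLp.smul_apply]
    fun_prop

namespace IsLipschitzGraphOver

theorem norm_direction_sub_le_capCoord (hS : IsLipschitzGraphOver J K S)
    (hΘ : Θ ∈ dominatedCone S k) (hΦ : Φ ∈ dominatedCone S k) :
    ‖(Θ k)⁻¹ • Θ - (Φ k)⁻¹ • Φ‖ ≤ K * dist (capCoord k Z Θ) (capCoord k Z Φ) := by
  refine hS.norm_sub_le hΘ.2.1 hΦ.2.1 dist_nonneg fun i hi => ?_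
  rcases eq_or_ne (⟨i, hi⟩ : J) k with rfl | hik
  · simp [hΘ.1, hΦ.1]
  · have h := dist_le_pi_dist (capCoord k Z Θ) (capCoord k Z Φ) ⟨i, hi⟩
    rwa [capCoord_of_ne hik, capCoord_of_ne hik, dist_eq_norm] at h

theorem norm_coord_sub_le_capCoord (hS : IsLipschitzGraphOver J K S) (hZ : ‖Z‖ < 1) (hr : 0 ≤ r)
    (hr1 : r ≤ 1) (hΘ : Θ ∈ cap Z r ∩ dominatedCone S k)
    (hΦ : Φ ∈ cap Z r ∩ dominatedCone S k) :
    ‖Θ k - Φ k‖ ≤ 2 * (1 + K) * dist (capCoord k Z Θ) (capCoord k Z Φ) := by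
  set D := dist (capCoord k Z Θ) (capCoord k Z Φ)
  have hinner : ‖inner ℂ Z Θ - inner ℂ Z Φ‖ ≤ D := by
    rw [← capCoord_self (k := k) (Θ := Θ), ← capCoord_self (k := k) (Θ := Φ), ← dist_eq_norm]
    exact dist_le_pi_dist _ _ k
  have hid : (Θ k - Φ k) * inner ℂ Z ((Θ k)⁻¹ • Θ) = inner ℂ Z Θ - inner ℂ Z Φ
      - Φ k * inner ℂ Z ((Θ k)⁻¹ • Θ - (Φ k)⁻¹ • Φ) := by
    have hΘk : inner ℂ Z Θ = Θ k * inner ℂ Z ((Θ k)⁻¹ • Θ) := by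
      rw [← inner_smul_right, smul_inv_smul₀ hΘ.2.1 Θ]
    have hΦk : inner ℂ Z Φ = Φ k * inner ℂ Z ((Φ k)⁻¹ • Φ) := by
      rw [← inner_smul_right, smul_inv_smul₀ hΦ.2.1 Φ]
    rw [hΘk, hΦk, inner_sub_right]
    ring
  have hΦk : ‖Φ k‖ ≤ 1 := (PiLp.norm_apply_le Φ k).trans hΦ.1.1.le
  have hup : ‖Θ k - Φ k‖ * ‖inner ℂ Z ((Θ k)⁻¹ • Θ)‖ ≤ D + 1 * (1 * (K * D)) := by
    rw [← norm_mul, hid]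
    refine (_root_.norm_sub_le _ _).trans ?_
    rw [norm_mul]
    gcongr
    refine (norm_inner_le_norm _ _).trans ?_
    gcongr
    exact hS.norm_direction_sub_le_capCoord hΘ.2 hΦ.2
  nlinarith [half_le_norm_inner_direction hr hr1 hΘ, norm_nonneg (Θ k - Φ k)]

theorem antilipschitzWith_capCoord (hS : IsLipschitzGraphOver J K S) (hZ : ‖Z‖ < 1) (hr : 0 ≤ r)
    (hr1 : r ≤ 1) :
    AntilipschitzWith (K * (2 * K + 3)) ((cap Z r ∩ dominatedCone S k).domRestrict
      (capCoord k Z)) := by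
  refine AntilipschitzWith.of_le_mul_dist fun Θ Φ => ?_
  obtain ⟨Θ, hΘ⟩ := Θ
  obtain ⟨Φ, hΦ⟩ := Φ
  have hid : Θ - Φ = (Θ k - Φ k) • (Θ k)⁻¹ • Θ + Φ k • ((Θ k)⁻¹ • Θ - (Φ k)⁻¹ • Φ) := by
    rw [sub_smul, smul_sub, smul_inv_smul₀ hΘ.2.1 Θ, smul_inv_smul₀ hΦ.2.1 Φ]
    abel
  have hΦk : ‖Φ k‖ ≤ 1 := (PiLp.norm_apply_le Φ k).trans hΦ.1.1.le
  set D := dist (capCoord k Z Θ) (capCoord k Z Φ)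
  calc dist Θ Φ ≤ ‖Θ k - Φ k‖ * ‖(Θ k)⁻¹ • Θ‖ + ‖Φ k‖ * ‖(Θ k)⁻¹ • Θ - (Φ k)⁻¹ • Φ‖ := by
        rw [dist_eq_norm, hid, ← norm_smul, ← norm_smul]
        exact norm_add_le _ _
    _ ≤ 2 * (1 + K) * D * K + 1 * (K * D) := by
        gcongr
        · exact hS.norm_coord_sub_le_capCoord hZ hr hr1 hΘ hΦ
        · exact hS.norm_direction_le hΘ.2
        · exact hS.norm_direction_sub_le_capCoord hΘ.2 hΦ.2
    _ = (K * (2 * K + 3) : ℝ≥0) * D := by push_cast; ring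

theorem prod_singularWeight_le_capMajorant (hS : IsLipschitzGraphOver J K S)
    (h : AdmissibleExponents J δ κ) (hZ : ‖Z‖ < 1) (hr : 0 ≤ r) (hr1 : r ≤ 1)
    (hΘ : Θ ∈ cap Z r ∩ dominatedCone S k) (hΦ : Φ ∈ cap Z r ∩ dominatedCone S k) :
    ∏ i, singularWeight (δ i) (κ i) r (Θ i)
      ≤ (∏ i : J, ((2 * K) ^ (δ i + κ i) : ℝ).toNNReal : ℝ≥0)
        * ∏ i : J, capMajorant δ κ k (4 * K * (1 + K) + 1) r
            (freeCoords J ((Φ k)⁻¹ • Φ)) i (capCoord k Z Θ i) := by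
  rw [h.prod_singularWeight, ← Finset.prod_coe_sort, ENNReal.ofNNReal_finsetProd,
    ← Finset.prod_mul_distrib]
  refine Finset.prod_le_prod' fun i _ =>
    (hS.singularWeight_apply_le h hZ hr hr1 hΘ i).trans (mul_le_mul' le_rfl ?_)
  rcases eq_or_ne i k with rfl | hi
  · have hmem : inner ℂ Z Θ ∈ closedBall (1 : ℂ) (r ^ 2 / 2) := by
      rw [mem_closedBall, dist_eq_norm, norm_sub_rev]
      exact hΘ.1.2.le
    rw [capMajorant, if_pos rfl, capCoord_self, Set.indicator_of_mem hmem, Pi.one_apply]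
    exact (singularWeight_of_norm_eq_one (by simp [hΘ.2.1]) hr1).le
  · have hmem : ((Θ k)⁻¹ • Θ) i ∈
        closedBall (freeCoords J ((Φ k)⁻¹ • Φ) i) ((4 * K * (1 + K) + 1) * r) := by
      rw [mem_closedBall, dist_eq_norm]
      have := PiLp.norm_apply_le ((Θ k)⁻¹ • Θ - (Φ k)⁻¹ • Φ) i
      have := hS.norm_direction_sub_le_of_mem_cap hZ hr hr1 hΘ hΦ
      simp only [freeCoords, PiLp.sub_apply] at *
      linarith
    rw [capMajorant, if_neg hi, capCoord_of_ne hi, Set.indicator_of_mem hmem]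

end IsLipschitzGraphOver

end CapCoord

theorem IsLipschitzGraphOver.exists_setLIntegral_cap_le (hS : IsLipschitzGraphOver J K S)
    (h : AdmissibleExponents J δ κ) (k : J) :
    ∃ C : ℝ≥0, ∀ (Z : EuclideanSpace ℂ ι) (r : ℝ), ‖Z‖ < 1 → 0 < r → r ≤ 1 →
      ∫⁻ Θ in cap Z r ∩ dominatedCone S k, ∏ i, singularWeight (δ i) (κ i) r (Θ i)
          ∂μHE[2 * J.card]
        ≤ C * ENNReal.ofReal (r ^ (2 * J.card + 2 - ∑ i, κ i)) := by
  classical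
  choose C hC using
    exists_lintegral_capMajorant_le h k (A := 4 * K * (1 + K) + 1) (by positivity)
  obtain ⟨C₀, hC₀⟩ := exists_setLIntegral_euclideanHausdorffMeasure_le
    (X := EuclideanSpace ℂ ι) (volume : Measure (J → ℂ)) (K * (2 * K + 3))
  set C₁ : ℝ≥0 := ∏ i : J, ((2 * K) ^ (δ i + κ i) : ℝ).toNNReal
  refine ⟨C₀ * (C₁ * ∏ i, C i), fun Z r hZ hr hr1 => ?_⟩
  rcases (cap Z r ∩ dominatedCone S k).eq_empty_or_nonempty with hempty | ⟨Φ, hΦ⟩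
  · simp [hempty]
  have hexp : ∑ i : J, (2 - κ i + (Pi.single k 2 : J → ℝ) i) = 2 * J.card + 2 - ∑ i, κ i := by
    rw [Finset.sum_add_distrib, Finset.sum_sub_distrib, Finset.sum_coe_sort J κ,
      Finset.sum_subset J.subset_univ fun i _ hi => h.right_eq_zero i hi]
    simp
    ring
  set f := capMajorant δ κ k (4 * K * (1 + K) + 1) r (freeCoords J ((Φ k)⁻¹ • Φ))
  have hf (i : J) : Measurable (f i) := measurable_capMajorant k _ r _ i
  rw [← finrank_pi_complex]
  calc _ ≤ C₀ * ∫⁻ y : J → ℂ, C₁ * ∏ i, f i (y i) :=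
        hC₀ _ _ _ (fun y => C₁ * ∏ i, f i (y i)) (measurable_capCoord k Z) (by fun_prop)
          (hS.antilipschitzWith_capCoord hZ hr.le hr1) fun Θ hΘ =>
            hS.prod_singularWeight_le_capMajorant h hZ hr.le hr1 hΘ hΦ
    _ ≤ C₀ * (C₁ * ((∏ i, C i : ℝ≥0)
          * ENNReal.ofReal (r ^ ∑ i : J, (2 - κ i + (Pi.single k 2 : J → ℝ) i)))) := by
        rw [lintegral_const_mul _ (by fun_prop)]
        gcongr
        exact lintegral_prod_apply_le volume hf hr fun i => hC i _ r hr hr1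
    _ = _ := by rw [hexp]; push_cast; ring

end Cap

/-! ### The quadric cone -/

section Isotropic

variable {ι : Type} [Fintype ι] {u v : EuclideanSpace ℂ ι} {p : ι × Fin 4} {D : ℝ}

/-- The `q`-th of four sectors of opening `2π/3` that cover the plane. -/
def sector (q : Fin 4) : Set ℂ := {a | ‖a‖ ≤ 2 * (Complex.I ^ (q : ℕ) * a).re}

theorem exists_mem_sector (a : ℂ) : ∃ q, a ∈ sector q := by
  have h := Complex.norm_le_abs_re_add_abs_im a
  simp only [sector, Set.mem_ofPred_eq, Fin.exists_fin_succ]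
  simp [pow_succ, Complex.I_mul]
  grind

theorem norm_add_norm_le_of_mem_sector {q : Fin 4} {a b : ℂ} (ha : a ∈ sector q)
    (hb : b ∈ sector q) : ‖a‖ + ‖b‖ ≤ 2 * ‖a + b‖ := by
  have h : (Complex.I ^ (q : ℕ) * (a + b)).re ≤ ‖a + b‖ := by
    simpa using Complex.re_le_norm (Complex.I ^ (q : ℕ) * (a + b))
  rw [mul_add, Complex.add_re] at h
  have ha' : ‖a‖ ≤ _ := ha
  have hb' : ‖b‖ ≤ _ := hb
  linarith

theorem bdot_smul_self (c : ℂ) (v : EuclideanSpace ℂ ι) :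
    bdot (c • v) (c • v) = c ^ 2 * bdot v v := by
  simp only [bdot, PiLp.smul_apply, smul_eq_mul, Finset.mul_sum]
  exact Finset.sum_congr rfl fun i _ => by ring

/-- The vectors of the cone `v • v = 0` whose largest coordinate is the one with index `p.1`, this
coordinate being in the sector `p.2`. -/
def isotropicPiece (p : ι × Fin 4) : Set (EuclideanSpace ℂ ι) :=
  {v | bdot v v = 0 ∧ (∀ i, ‖v i‖ ≤ ‖v p.1‖) ∧ v p.1 ∈ sector p.2}

theorem zero_mem_isotropicPiece (p : ι × Fin 4) : 0 ∈ isotropicPiece p := by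
  simp [isotropicPiece, sector, bdot]

theorem norm_sub_mul_norm_add_le_of_mem_isotropicPiece (hu : u ∈ isotropicPiece p)
    (hv : v ∈ isotropicPiece p) (hD : 0 ≤ D) (h : ∀ i ≠ p.1, ‖u i - v i‖ ≤ D) :
    ‖u p.1 - v p.1‖ * ‖u p.1 + v p.1‖ ≤ Fintype.card ι * D * (‖u p.1‖ + ‖v p.1‖) := by
  classical
  have hid : (u p.1 - v p.1) * (u p.1 + v p.1)
      = -∑ i ∈ Finset.univ.erase p.1, (u i - v i) * (u i + v i) := by
    rw [← add_eq_zero_iff_eq_neg, Finset.add_sum_erase _ (fun i => (u i - v i) * (u i + v i))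
      (Finset.mem_univ p.1)]
    calc ∑ i, (u i - v i) * (u i + v i) = bdot u u - bdot v v := by
          rw [bdot, bdot, ← Finset.sum_sub_distrib]
          exact Finset.sum_congr rfl fun i _ => by ring
      _ = 0 := by rw [hu.1, hv.1, sub_zero]
  rw [← norm_mul, hid, norm_neg]
  calc _ ≤ ∑ _ ∈ Finset.univ.erase p.1, D * (‖u p.1‖ + ‖v p.1‖) := by
        refine norm_sum_le_of_le _ fun i hi => ?_
        rw [norm_mul]
        gcongr
        · exact h i (Finset.ne_of_mem_erase hi)
        · exact (norm_add_le _ _).trans (add_le_add (hu.2.1 i) (hv.2.1 i))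
    _ ≤ ∑ _ : ι, D * (‖u p.1‖ + ‖v p.1‖) :=
        Finset.sum_le_sum_of_subset_of_nonneg (Finset.erase_subset _ _) fun _ _ _ => by positivity
    _ = _ := by simp [mul_assoc]

theorem norm_apply_sub_le_of_mem_isotropicPiece (hu : u ∈ isotropicPiece p)
    (hv : v ∈ isotropicPiece p) (hD : 0 ≤ D) (h : ∀ i ≠ p.1, ‖u i - v i‖ ≤ D) (i : ι) :
    ‖u i - v i‖ ≤ 2 * Fintype.card ι * D := by
  have hcard : (1 : ℝ) ≤ Fintype.card ι := by exact_mod_cast Fintype.card_pos_iff.mpr ⟨i⟩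
  rcases eq_or_ne i p.1 with rfl | hi
  · rcases (norm_nonneg (u p.1 + v p.1)).eq_or_lt with h0 | hpos
    · have := norm_add_norm_le_of_mem_sector hu.2.2 hv.2.2
      have hdiff := norm_sub_le (u p.1) (v p.1)
      have : 0 ≤ 2 * Fintype.card ι * D := by positivity
      linarith
    · refine le_of_mul_le_mul_right ?_ hpos
      calc _ ≤ Fintype.card ι * D * (‖u p.1‖ + ‖v p.1‖) :=
            norm_sub_mul_norm_add_le_of_mem_isotropicPiece hu hv hD h
        _ ≤ Fintype.card ι * D * (2 * ‖u p.1 + v p.1‖) := by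
            gcongr
            exact norm_add_norm_le_of_mem_sector hu.2.2 hv.2.2
        _ = _ := by ring
  · nlinarith [h i hi]

theorem exists_mem_isotropicPiece [Nonempty ι] (hv : bdot v v = 0) :
    ∃ p, v ∈ isotropicPiece p := by
  obtain ⟨j, hj⟩ := Finite.exists_max fun i => ‖v i‖
  obtain ⟨q, hq⟩ := exists_mem_sector (v j)
  exact ⟨(j, q), hv, hj, hq⟩

theorem exists_smul_mem_isotropicPiece (hv : v ∈ isotropicPiece p) (c : ℂ) :
    ∃ q, c • v ∈ isotropicPiece (p.1, q) := by
  obtain ⟨q, hq⟩ := exists_mem_sector (c • v p.1)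
  refine ⟨q, by rw [bdot_smul_self, hv.1, mul_zero], fun i => ?_, hq⟩
  simp only [PiLp.smul_apply, norm_smul]
  gcongr
  exact hv.2.1 i

end Isotropic

section Piece

variable {l n m : ℕ} {Z Θ : AmbN l n m}

/-- The points of the cone `z • z = w • w = 0` both of whose blocks lie in prescribed pieces. -/
def isotropicPieceN (l : ℕ) {n m : ℕ} (p : (Fin (n + 1) × Fin 4) × (Fin (m + 1) × Fin 4)) :
    Set (AmbN l n m) :=
  {Θ | partZ Θ ∈ isotropicPiece p.1 ∧ partW Θ ∈ isotropicPiece p.2}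

/-- All indices except that of the largest coordinate of each of the two blocks. -/
def freeIndices (l : ℕ) {n m : ℕ} (p : (Fin (n + 1) × Fin 4) × (Fin (m + 1) × Fin 4)) :
    Finset (Fin l ⊕ (Fin (n + 1) ⊕ Fin (m + 1))) :=
  {Sum.inr (Sum.inl p.1.1), Sum.inr (Sum.inr p.2.1)}ᶜ

theorem card_freeIndices (p : (Fin (n + 1) × Fin 4) × (Fin (m + 1) × Fin 4)) :
    (freeIndices l p).card = l + n + m := by
  rw [freeIndices, Finset.card_compl, Finset.card_pair (by simp)]
  simp
  omega

theorem exists_isLipschitzGraphOver_isotropicPieceN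
    (p : (Fin (n + 1) × Fin 4) × (Fin (m + 1) × Fin 4)) :
    ∃ K : ℝ≥0, IsLipschitzGraphOver (freeIndices l p) K (isotropicPieceN l p) := by
  refine IsLipschitzGraphOver.exists_of_norm_apply_sub_le
    ⟨zero_mem_isotropicPiece p.1, zero_mem_isotropicPiece p.2⟩
    (2 * (n + 1) + 2 * (m + 1)) fun Θ hΘ Φ hΦ D hD h => ?_
  have hn : 0 ≤ (n : ℝ) * D := by positivity
  have hm : 0 ≤ (m : ℝ) * D := by positivity
  push_cast
  rintro (i | i | i)
  · have := h (Sum.inl i) (by simp [freeIndices])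
    linarith
  · have := norm_apply_sub_le_of_mem_isotropicPiece hΘ.1 hΦ.1 hD
      (fun i hi => h (Sum.inr (Sum.inl i)) (by simp [freeIndices, hi])) i
    simp only [Fintype.card_fin, Nat.cast_add, Nat.cast_one, partZ] at this
    linarith
  · have := norm_apply_sub_le_of_mem_isotropicPiece hΘ.2 hΦ.2 hD
      (fun i hi => h (Sum.inr (Sum.inr i)) (by simp [freeIndices, hi])) i
    simp only [Fintype.card_fin, Nat.cast_add, Nat.cast_one, partW] at this
    linarith

end Piece

section Weight

variable {l n m : ℕ} {Z Θ : AmbN l n m}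

/-- The product of the weights of the two blocks in the integrand. -/
noncomputable def weightN (α₁ α₂ α₃ α₄ : ℝ) (Z Θ : AmbN l n m) : ℝ≥0∞ :=
  blockWeight α₁ α₃ (Fin.last n) (partZ Z) (partZ Θ)
    * blockWeight α₂ α₄ (Fin.last m) (partW Z) (partW Θ)

theorem measurable_partZ : Measurable (partZ : AmbN l n m → _) := by
  unfold partZ; fun_prop

theorem measurable_partW : Measurable (partW : AmbN l n m → _) := by
  unfold partW; fun_prop

theorem measurable_weightN (α₁ α₂ α₃ α₄ : ℝ) (Z : AmbN l n m) :
    Measurable (weightN α₁ α₂ α₃ α₄ Z) :=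
  ((measurable_blockWeight _ _ _ _).comp measurable_partZ).mul
    ((measurable_blockWeight _ _ _ _).comp measurable_partW)

theorem norm_toLp_comp_le {ι κ : Type*} [Fintype ι] [Fintype κ] (f : ι ↪ κ)
    (x : EuclideanSpace ℂ κ) : ‖(WithLp.toLp 2 fun i => x (f i) : EuclideanSpace ℂ ι)‖ ≤ ‖x‖ := by
  rw [EuclideanSpace.norm_eq, EuclideanSpace.norm_eq]
  refine Real.sqrt_le_sqrt ?_
  calc ∑ i, ‖x (f i)‖ ^ 2 = ∑ j ∈ Finset.univ.map f, ‖x j‖ ^ 2 :=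
        (Finset.sum_map _ f fun j => ‖x j‖ ^ 2).symm
    _ ≤ ∑ j, ‖x j‖ ^ 2 := Finset.sum_le_univ_sum_of_nonneg fun _ => sq_nonneg _

theorem norm_partZ_le (Θ : AmbN l n m) : ‖partZ Θ‖ ≤ ‖Θ‖ :=
  norm_toLp_comp_le (Function.Embedding.inl.trans Function.Embedding.inr) Θ

theorem norm_partW_le (Θ : AmbN l n m) : ‖partW Θ‖ ≤ ‖Θ‖ :=
  norm_toLp_comp_le (Function.Embedding.inr.trans Function.Embedding.inr) Θ

theorem AdmissibleExponents.sumElim {p : (Fin (n + 1) × Fin 4) × (Fin (m + 1) × Fin 4)}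
    {δ₁ κ₁ : Fin (n + 1) → ℝ} {δ₂ κ₂ : Fin (m + 1) → ℝ}
    (h₁ : AdmissibleExponents {p.1.1}ᶜ δ₁ κ₁) (h₂ : AdmissibleExponents {p.2.1}ᶜ δ₂ κ₂) :
    AdmissibleExponents (freeIndices l p) (Sum.elim 0 (Sum.elim δ₁ δ₂))
      (Sum.elim 0 (Sum.elim κ₁ κ₂)) where
  left_nonneg := by
    rintro (_ | i | i)
    exacts [le_rfl, h₁.left_nonneg i, h₂.left_nonneg i]
  right_nonneg := by
    rintro (_ | i | i)
    exacts [le_rfl, h₁.right_nonneg i, h₂.right_nonneg i]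
  add_lt_two := by
    rintro (i | i | i)
    exacts [by simp, h₁.add_lt_two i, h₂.add_lt_two i]
  left_eq_zero := by
    rintro (i | i | i) hi
    exacts [rfl, h₁.left_eq_zero i (by simpa [freeIndices] using hi),
      h₂.left_eq_zero i (by simpa [freeIndices] using hi)]
  right_eq_zero := by
    rintro (i | i | i) hi
    exacts [rfl, h₁.right_eq_zero i (by simpa [freeIndices] using hi),
      h₂.right_eq_zero i (by simpa [freeIndices] using hi)]

/-- The range of the exponents `β` of `1 + |z| / |ζ|` and `α` of `|ζ / ζ_{d+1}|` for which the
singularities of the weight are integrable on the quadric cone of dimension `d`. -/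
structure SubcriticalExponents (d : ℕ) (β α : ℝ) : Prop where
  pos : 0 < d
  nonneg : 0 ≤ α
  lt_two : α < 2
  add_lt : β + α < 2 * d

section Estimates

variable {α₁ α₂ α₃ α₄ : ℝ}

theorem exists_weightN_le_prod_singularWeight (hz : SubcriticalExponents n α₁ α₃)
    (hw : SubcriticalExponents m α₂ α₄)
    (p : (Fin (n + 1) × Fin 4) × (Fin (m + 1) × Fin 4)) :
    ∃ (C : ℝ≥0) (δ κ : Fin l ⊕ (Fin (n + 1) ⊕ Fin (m + 1)) → ℝ),
      AdmissibleExponents (freeIndices l p) δ κ ∧ ∑ i, κ i = α₃ + α₄ ∧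
      ∀ (Z Θ : AmbN l n m) (r : ℝ) (c : ℂ), c ≠ 0 → c • Θ ∈ isotropicPieceN l p → ‖Θ‖ ≤ 1 →
        ‖Θ - Z‖ ≤ r →
        weightN α₁ α₂ α₃ α₄ Z Θ ≤ C * ∏ i, singularWeight (δ i) (κ i) r (Θ i) := by
  obtain ⟨C₁, δ₁, κ₁, hadm₁, hκ₁, hC₁⟩ := exists_blockWeight_le_prod_singularWeight hz.nonneg
    hz.lt_two (Fin.last n) p.1.1 (by simpa using hz.pos) (by simpa using hz.add_lt)
  obtain ⟨C₂, δ₂, κ₂, hadm₂, hκ₂, hC₂⟩ := exists_blockWeight_le_prod_singularWeight hw.nonneg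
    hw.lt_two (Fin.last m) p.2.1 (by simpa using hw.pos) (by simpa using hw.add_lt)
  refine ⟨C₁ * C₂, _, _, hadm₁.sumElim hadm₂, by simp [hκ₁, hκ₂], fun Z Θ r c hc hΘ hΘ1 hr => ?_⟩
  have hdomZ (i) : ‖partZ Θ i‖ ≤ ‖partZ Θ p.1.1‖ :=
    le_of_mul_le_mul_left (by simpa [partZ] using hΘ.1.2.1 i) (norm_pos_iff.mpr hc)
  have hdomW (i) : ‖partW Θ i‖ ≤ ‖partW Θ p.2.1‖ :=
    le_of_mul_le_mul_left (by simpa [partW] using hΘ.2.2.1 i) (norm_pos_iff.mpr hc)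
  calc weightN α₁ α₂ α₃ α₄ Z Θ
      ≤ (C₁ * ∏ i, singularWeight (δ₁ i) (κ₁ i) r (partZ Θ i))
        * (C₂ * ∏ i, singularWeight (δ₂ i) (κ₂ i) r (partW Θ i)) :=
        mul_le_mul'
          (hC₁ _ _ r hdomZ ((norm_partZ_le Θ).trans hΘ1) ((norm_partZ_le (Θ - Z)).trans hr))
          (hC₂ _ _ r hdomW ((norm_partW_le Θ).trans hΘ1) ((norm_partW_le (Θ - Z)).trans hr))
    _ = _ := by
        simp only [Fintype.prod_sum_type, Sum.elim_inl, Sum.elim_inr, Pi.zero_apply,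
          singularWeight_zero_zero, Finset.prod_const_one, partZ, partW]
        push_cast
        ring

theorem exists_setLIntegral_weightN_isotropicPieceN_le (hz : SubcriticalExponents n α₁ α₃)
    (hw : SubcriticalExponents m α₂ α₄)
    (p : (Fin (n + 1) × Fin 4) × (Fin (m + 1) × Fin 4)) :
    ∃ C : ℝ≥0, ∀ Z ∈ BallN l n m,
      ∫⁻ Θ in isotropicPieceN l p ∩ ball 0 1, weightN α₁ α₂ α₃ α₄ Z Θ ∂μHE[2 * (l + n + m)]
        ≤ C := by
  obtain ⟨C, δ, κ, hadm, -, hC⟩ :=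
    exists_weightN_le_prod_singularWeight (l := l) hz hw p
  obtain ⟨K, hK⟩ := exists_isLipschitzGraphOver_isotropicPieceN (l := l) p
  have hfin := hK.setLIntegral_prod_singularWeight_lt_top hadm two_pos
  rw [card_freeIndices] at hfin
  refine ⟨C * (∫⁻ Θ in isotropicPieceN l p ∩ ball 0 1,
    ∏ i, singularWeight (δ i) (κ i) 2 (Θ i) ∂μHE[2 * (l + n + m)]).toNNReal, fun Z hZ => ?_⟩
  rw [ENNReal.coe_mul, ENNReal.coe_toNNReal hfin.ne, ← lintegral_const_mul' _ _ ENNReal.coe_ne_top]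
  refine setLIntegral_mono ((measurable_prod_singularWeight δ κ 2).const_mul _) fun Θ hΘ =>
    hC Z Θ 2 1 one_ne_zero (by simpa using hΘ.1) ?_ ?_
  · exact (mem_ball_zero_iff.mp hΘ.2).le
  · linarith [norm_sub_le Θ Z, mem_ball_zero_iff.mp hΘ.2, mem_ball_zero_iff.mp hZ]

theorem exists_setLIntegral_weightN_cap_le (hz : SubcriticalExponents n α₁ α₃)
    (hw : SubcriticalExponents m α₂ α₄)
    (p : (Fin (n + 1) × Fin 4) × (Fin (m + 1) × Fin 4)) (k : freeIndices l p) :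
    ∃ C : ℝ≥0, ∀ Z ∈ BallN l n m, ∀ r : ℝ, 0 < r → r ≤ 1 →
      ∫⁻ Θ in cap Z r ∩ dominatedCone (isotropicPieceN l p) k, weightN α₁ α₂ α₃ α₄ Z Θ
          ∂μHE[2 * (l + n + m)]
        ≤ C * ENNReal.ofReal (r ^ (2 * ((l + n + m : ℕ) : ℝ) + 2 - (α₃ + α₄))) := by
  obtain ⟨C, δ, κ, hadm, hκ, hC⟩ :=
    exists_weightN_le_prod_singularWeight (l := l) hz hw p
  obtain ⟨K, hK⟩ := exists_isLipschitzGraphOver_isotropicPieceN (l := l) p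
  obtain ⟨C', hC'⟩ := hK.exists_setLIntegral_cap_le hadm k
  rw [card_freeIndices, hκ] at hC'
  refine ⟨C * C', fun Z hZ r hr hr1 => ?_⟩
  have hZ1 : ‖Z‖ < 1 := mem_ball_zero_iff.mp hZ
  rw [ENNReal.coe_mul, mul_assoc]
  refine le_trans ?_ (mul_le_mul' le_rfl (hC' Z r hZ1 hr hr1))
  rw [← lintegral_const_mul' _ _ ENNReal.coe_ne_top]
  exact setLIntegral_mono ((measurable_prod_singularWeight δ κ r).const_mul _) fun Θ hΘ =>
    hC Z Θ r _ (inv_ne_zero hΘ.2.1) hΘ.2.2.1 hΘ.1.1.le (norm_sub_le_of_mem_cap hZ1 hr.le hΘ.1)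

theorem exists_mem_isotropicPieceN (h : Θ ∈ HypN l n m) : ∃ p, Θ ∈ isotropicPieceN l p := by
  obtain ⟨p₁, hp₁⟩ := exists_mem_isotropicPiece h.2.2.1
  obtain ⟨p₂, hp₂⟩ := exists_mem_isotropicPiece h.2.2.2
  exact ⟨(p₁, p₂), hp₁, hp₂⟩

theorem exists_mem_dominatedCone (h : Θ ∈ HypN l n m) :
    ∃ x : Σ p, freeIndices l p, Θ ∈ dominatedCone (isotropicPieceN l x.1) x.2 := by
  obtain ⟨p, hp⟩ := exists_mem_isotropicPieceN h
  obtain ⟨K, hK⟩ := exists_isLipschitzGraphOver_isotropicPieceN (l := l) p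
  have h0 : Θ ≠ 0 := by
    rintro rfl
    exact h.1 rfl
  obtain ⟨k, hk0, hk⟩ := hK.exists_dominant_coord hp h0
  obtain ⟨q₁, hq₁⟩ := exists_smul_mem_isotropicPiece hp.1 (Θ k)⁻¹
  obtain ⟨q₂, hq₂⟩ := exists_smul_mem_isotropicPiece hp.2 (Θ k)⁻¹
  exact ⟨⟨((p.1.1, q₁), (p.2.1, q₂)), k⟩, hk0, ⟨hq₁, hq₂⟩, hk⟩

theorem exists_setLIntegral_weightN_manN_le (hz : SubcriticalExponents n α₁ α₃)
    (hw : SubcriticalExponents m α₂ α₄) :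
    ∃ C : ℝ≥0, ∀ Z ∈ BallN l n m,
      ∫⁻ Θ in ManN l n m, weightN α₁ α₂ α₃ α₄ Z Θ ∂μHE[2 * (l + n + m)] ≤ C := by
  choose C hC using exists_setLIntegral_weightN_isotropicPieceN_le (l := l) hz hw
  refine ⟨∑ p, C p, fun Z hZ => ?_⟩
  rw [← mul_one (ENNReal.ofNNReal _)]
  refine setLIntegral_le_sum_mul_of_subset_iUnion (fun Θ hΘ => ?_)
    fun p => (hC p Z hZ).trans_eq (mul_one _).symm
  obtain ⟨p, hp⟩ := exists_mem_isotropicPieceN hΘ.1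
  exact Set.mem_iUnion_of_mem p ⟨hp, hΘ.2⟩

theorem exists_setLIntegral_weightN_hypN_inter_cap_le (hz : SubcriticalExponents n α₁ α₃)
    (hw : SubcriticalExponents m α₂ α₄) :
    ∃ C : ℝ≥0, ∀ Z ∈ BallN l n m, ∀ r : ℝ, 0 < r → r ≤ 1 →
      ∫⁻ Θ in HypN l n m ∩ cap Z r, weightN α₁ α₂ α₃ α₄ Z Θ ∂μHE[2 * (l + n + m)]
        ≤ C * ENNReal.ofReal (r ^ (2 * ((l + n + m : ℕ) : ℝ) + 2 - (α₃ + α₄))) := by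
  choose C hC using exists_setLIntegral_weightN_cap_le (l := l) hz hw
  refine ⟨∑ x : Σ p, freeIndices l p, C x.1 x.2, fun Z hZ r hr hr1 => ?_⟩
  refine setLIntegral_le_sum_mul_of_subset_iUnion (fun Θ hΘ => ?_)
    fun x => hC x.1 x.2 Z hZ r hr hr1
  obtain ⟨x, hx⟩ := exists_mem_dominatedCone hΘ.1
  exact Set.mem_iUnion_of_mem x ⟨hΘ.2, hx⟩

theorem inner_eq_bdot_vconj (Z Θ : AmbN l n m) : inner ℂ Z Θ = bdot Θ (vconj Z) := by
  simp [PiLp.inner_apply, bdot, vconj]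

theorem sublevel_subset_hypN_inter_cap (Z : AmbN l n m) {t : ℝ} (ht : 0 ≤ t) :
    {Θ ∈ ManN l n m | ‖1 - bdot Θ (vconj Z)‖ < t} ⊆ HypN l n m ∩ cap Z √(2 * t) := by
  rintro Θ ⟨⟨hΘ, hΘ1⟩, hΘt⟩
  refine ⟨hΘ, mem_ball_zero_iff.mp hΘ1, ?_⟩
  rwa [inner_eq_bdot_vconj, Real.sq_sqrt (by positivity), mul_div_cancel_left₀ t two_ne_zero]

theorem exists_setLIntegral_weightN_sublevel_le (hz : SubcriticalExponents n α₁ α₃)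
    (hw : SubcriticalExponents m α₂ α₄) :
    ∃ C : ℝ≥0, ∀ Z ∈ BallN l n m, ∀ t : ℝ, 0 < t →
      ∫⁻ Θ in {Θ ∈ ManN l n m | ‖1 - bdot Θ (vconj Z)‖ < t}, weightN α₁ α₂ α₃ α₄ Z Θ
          ∂μHE[2 * (l + n + m)]
        ≤ C * ENNReal.ofReal (t ^ (((l + n + m : ℕ) : ℝ) + 1 - (α₃ + α₄) / 2)) := by
  set e : ℝ := ((l + n + m : ℕ) : ℝ) + 1 - (α₃ + α₄) / 2 with he_def
  have he : 0 ≤ e := by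
    have : (1 : ℝ) ≤ (l + n + m : ℕ) := by exact_mod_cast (by have := hz.pos; omega)
    linarith [hz.lt_two, hw.lt_two]
  obtain ⟨C₁, hC₁⟩ := exists_setLIntegral_weightN_manN_le (l := l) hz hw
  obtain ⟨C₂, hC₂⟩ := exists_setLIntegral_weightN_hypN_inter_cap_le (l := l) hz hw
  refine ⟨max C₁ C₂ * (2 ^ e : ℝ).toNNReal, fun Z hZ t ht => ?_⟩
  have hconst : ((max C₁ C₂ * (2 ^ e : ℝ).toNNReal : ℝ≥0) : ℝ≥0∞) * ENNReal.ofReal (t ^ e)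
      = max C₁ C₂ * ENNReal.ofReal ((2 * t) ^ e) := by
    rw [Real.mul_rpow zero_le_two ht.le, ENNReal.ofReal_mul (by positivity), ENNReal.coe_mul,
      mul_assoc, ENNReal.ofReal]
    push_cast
    rfl
  rw [hconst]
  rcases le_total (2 * t) 1 with h | h
  · have hpow : √(2 * t) ^ (2 * ((l + n + m : ℕ) : ℝ) + 2 - (α₃ + α₄)) = (2 * t) ^ e := by
      rw [Real.sqrt_eq_rpow, ← Real.rpow_mul (by positivity), he_def]
      ring_nf
    calc _ ≤ (C₂ : ℝ≥0∞) * ENNReal.ofReal ((2 * t) ^ e) := by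
          rw [← hpow]
          exact (lintegral_mono_set (sublevel_subset_hypN_inter_cap Z ht.le)).trans
            (hC₂ Z hZ _ (Real.sqrt_pos.mpr (by positivity)) (Real.sqrt_le_one.mpr h))
      _ ≤ _ := by
          gcongr
          exact le_max_right _ _
  · calc _ ≤ (C₁ : ℝ≥0∞) * 1 := by
          rw [mul_one]
          exact (lintegral_mono_set fun Θ hΘ => hΘ.1).trans (hC₁ Z hZ)
      _ ≤ _ := by
          gcongr
          · exact le_max_left _ _
          · exact ENNReal.one_le_ofReal.mpr (Real.one_le_rpow h he)

theorem one_sub_sq_div_two_le_norm (hΘ : Θ ∈ ManN l n m) :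
    (1 - ‖Z‖ ^ 2) / 2 ≤ ‖1 - bdot Θ (vconj Z)‖ := by
  have hΘ1 : ‖Θ‖ < 1 := mem_ball_zero_iff.mp hΘ.2
  have hinner : ‖bdot Θ (vconj Z)‖ ≤ ‖Z‖ := by
    rw [← inner_eq_bdot_vconj]
    exact (norm_inner_le_norm Z Θ).trans (mul_le_of_le_one_right (norm_nonneg _) hΘ1.le)
  have hsub := norm_sub_norm_le 1 (bdot Θ (vconj Z))
  rw [norm_one] at hsub
  nlinarith [sq_nonneg (1 - ‖Z‖)]

theorem kernelN_mul_weights (lam : ℝ) (Z Θ : AmbN l n m) :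
    ENNReal.ofReal (kernelN lam Z Θ)
        * (1 + ‖partZ Z‖ₑ / ‖partZ Θ‖ₑ) ^ α₁
        * (1 + ‖partW Z‖ₑ / ‖partW Θ‖ₑ) ^ α₂
        * (‖partZ Θ‖ₑ / ‖partZ Θ (Fin.last n)‖ₑ) ^ α₃
        * (‖partW Θ‖ₑ / ‖partW Θ (Fin.last m)‖ₑ) ^ α₄
      = ENNReal.ofReal (‖1 - bdot Θ (vconj Z)‖ ^ (-(((l + n + m : ℕ) : ℝ) + 1 + lam)))
        * weightN α₁ α₂ α₃ α₄ Z Θ := by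
  rw [kernelN, one_div, ← Real.rpow_neg (norm_nonneg _), weightN, blockWeight, blockWeight]
  ring

theorem exists_setLIntegral_rpow_mul_weightN_le {lam : ℝ} (hz : SubcriticalExponents n α₁ α₃)
    (hw : SubcriticalExponents m α₂ α₄) (hlam : 0 < lam + α₃ / 2 + α₄ / 2) :
    ∃ C : ℝ, 0 ≤ C ∧ ∀ Z ∈ BallN l n m,
      ∫⁻ Θ in ManN l n m,
          ENNReal.ofReal (‖1 - bdot Θ (vconj Z)‖ ^ (-(((l + n + m : ℕ) : ℝ) + 1 + lam)))
            * weightN α₁ α₂ α₃ α₄ Z Θ ∂μHE[2 * (l + n + m)]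
        ≤ ENNReal.ofReal (C * (1 - ‖Z‖ ^ 2) ^ (-(lam + α₃ / 2 + α₄ / 2))) := by
  obtain ⟨C, hC⟩ := exists_setLIntegral_weightN_sublevel_le (l := l) hz hw
  have he : 0 ≤ ((l + n + m : ℕ) : ℝ) + 1 - (α₃ + α₄) / 2 := by
    have : (1 : ℝ) ≤ (l + n + m : ℕ) := by exact_mod_cast (by have := hz.pos; omega)
    linarith [hz.lt_two, hw.lt_two]
  set e : ℝ := ((l + n + m : ℕ) : ℝ) + 1 - (α₃ + α₄) / 2
  set p : ℝ := ((l + n + m : ℕ) : ℝ) + 1 + lam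
  have hep : e - p = -(lam + α₃ / 2 + α₄ / 2) := by ring
  have hgeom : 0 ≤ 1 - (2 : ℝ) ^ (e - p) :=
    sub_nonneg.mpr (Real.rpow_le_one_of_one_le_of_nonpos one_le_two (by linarith))
  refine ⟨C * (2 ^ e * (1 - 2 ^ (e - p))⁻¹ * 2⁻¹ ^ (e - p)), by positivity, fun Z hZ => ?_⟩
  have hpos : 0 < 1 - ‖Z‖ ^ 2 := by
    have : ‖Z‖ < 1 := mem_ball_zero_iff.mp hZ
    nlinarith [norm_nonneg Z]
  calc _ ≤ C * ENNReal.ofReal (2 ^ e * (1 - 2 ^ (e - p))⁻¹ * ((1 - ‖Z‖ ^ 2) / 2) ^ (e - p)) :=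
        setLIntegral_rpow_neg_mul_le_of_sublevel (measurable_weightN _ _ _ _ Z) (by linarith)
          (by linarith) (by positivity) (fun Θ hΘ => one_sub_sq_div_two_le_norm hΘ) (hC Z hZ)
    _ = _ := by
        rw [div_eq_mul_inv, Real.mul_rpow hpos.le (by norm_num), ← ENNReal.ofReal_coe_nnreal,
          ← ENNReal.ofReal_mul C.coe_nonneg, ← hep]
        congr 1
        ring

end Estimates

end Weight

theorem theorem7p1_general (l n m : ℕ) (hn : 0 < n) (hm : 0 < m) (lam : ℝ)
    (α₁ α₂ α₃ α₄ : ℝ) (hlam : 0 < lam + α₃ / 2 + α₄ / 2) (h₃ : 0 ≤ α₃) (h₃' : α₃ < 2)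
    (h₄ : 0 ≤ α₄) (h₄' : α₄ < 2) (h₁₃' : α₁ + α₃ < 2 * (n : ℝ)) (h₂₄' : α₂ + α₄ < 2 * (m : ℝ)) :
    ∃ C : ℝ, 0 < C ∧ ∀ Z ∈ BallN l n m,
      (∫⁻ Θ in ManN l n m,
          ENNReal.ofReal (kernelN lam Z Θ)
            * (1 + ‖partZ Z‖ₑ / ‖partZ Θ‖ₑ) ^ α₁
            * (1 + ‖partW Z‖ₑ / ‖partW Θ‖ₑ) ^ α₂
            * (‖partZ Θ‖ₑ / ‖partZ Θ (Fin.last n)‖ₑ) ^ α₃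
            * (‖partW Θ‖ₑ / ‖partW Θ (Fin.last m)‖ₑ) ^ α₄ ∂(volN l n m))
        ≤ ENNReal.ofReal (C * (1 - ‖Z‖ ^ 2) ^ (-(lam + α₃ / 2 + α₄ / 2))) := by
  obtain ⟨C, hC0, hC⟩ := exists_setLIntegral_rpow_mul_weightN_le (l := l) ⟨hn, h₃, h₃', h₁₃'⟩
    ⟨hm, h₄, h₄', h₂₄'⟩ hlam
  refine ⟨C + 1, by positivity, fun Z hZ => ?_⟩
  have hpos : 0 ≤ 1 - ‖Z‖ ^ 2 :=
    sub_nonneg.mpr (pow_le_one₀ (norm_nonneg Z) (mem_ball_zero_iff.mp hZ).le)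
  simp only [kernelN_mul_weights]
  calc _ ≤ _ := lintegral_mono' (Measure.restrict_mono_measure Measure.restrict_le_self _) le_rfl
    _ ≤ _ := hC Z hZ
    _ ≤ _ := by
        gcongr
        exact le_add_of_nonneg_right zero_le_one

/-- The weights are computed in `[0,∞]`, so that `|ζ / ζₙ₊₁| = ∞` where `ζₙ₊₁ = 0`
(and likewise for `η`); the integral of the nonnegative integrand is the lower Lebesgue
integral, so its finiteness is part of the claim. -/
theorem theorem7p1 (l n m : ℕ) (hn : 1 < n) (hm : 1 < m) (lam : ℝ) (hlam : 0 < lam)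
    (α₁ α₂ α₃ α₄ : ℝ) (h₃ : 0 ≤ α₃) (h₃' : α₃ < 2) (h₄ : 0 ≤ α₄) (h₄' : α₄ < 2)
    (h₁₃ : 0 ≤ α₁ + α₃) (h₁₃' : α₁ + α₃ < 2 * (n : ℝ))
    (h₂₄ : 0 ≤ α₂ + α₄) (h₂₄' : α₂ + α₄ < 2 * (m : ℝ)) :
    ∃ C : ℝ, 0 < C ∧ ∀ Z ∈ BallN l n m,
      (∫⁻ Θ in ManN l n m,
          ENNReal.ofReal (kernelN lam Z Θ)
            * (1 + ‖partZ Z‖ₑ / ‖partZ Θ‖ₑ) ^ α₁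
            * (1 + ‖partW Z‖ₑ / ‖partW Θ‖ₑ) ^ α₂
            * (‖partZ Θ‖ₑ / ‖partZ Θ (Fin.last n)‖ₑ) ^ α₃
            * (‖partW Θ‖ₑ / ‖partW Θ (Fin.last m)‖ₑ) ^ α₄ ∂(volN l n m))
        ≤ ENNReal.ofReal (C * (1 - ‖Z‖ ^ 2) ^ (-(lam + α₃ / 2 + α₄ / 2))) :=
  theorem7p1_general l n m (by omega) (by omega) lam α₁ α₂ α₃ α₄ (by positivity) h₃ h₃' h₄ h₄'
    h₁₃' h₂₄'
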